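/- **Lemma A.1.** Let $n\ge 2$ and let $\Gamma\subset\mathbb R^n$ be an open cone ($\Gamma$ is open and $tx\in\Gamma$ for all $x\in\Gamma$, $t>0$) such that the complement $\mathbb S^{n-1}\setminus\hat\Gamma$ of its section $\hat\Gamma=\Gamma\cap\mathbb S^{n-1}$ has positive capacity in $\mathbb S^{n-1}$. Here the capacity of a compact set $A\subset\mathbb S^{n-1}$ is the infimum of $\int_{\mathbb S^{n-1}}(v^2+|\nabla_{\mathbb S^{n-1}}v|^2)\,d\sigma$ over all $v\in C^\infty(\mathbb S^{n-1})$ with $v\ge 1$ in a neighbourhood of $A$. All functions are real-valued. Let $\rho>0$, let $B(\rho)$ be the open ball of radius $\rho$ centred at $0$ and $B^\complement(\rho)=\mathbb R^n\setminus\overline{B(\rho)}$. For open $V\subset\mathbb R^n$ let $H^1(V)$ and $H^1_{\mathsf w}(V)$ be the spaces of functions $u$ on $V$ with distributional gradient $\nabla u\in L^2(V)$ and finite norm $$\|u\|_{H^1(V)}=\Big(\int_V |u|^2\,dx+\int_V|\nabla u|^2\,dx\Big)^{1/2},\qquad \|u\|_{H^1_{\mathsf w}(V)}=\Big(\int_V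 \frac{|u|^2}{(1+|x|)^{2}}\,dx+\int_V|\nabla u|^2\,dx\Big)^{1/2},$$ respectively. Let $H^1_0(\Gamma\cap\overline{B(\rho)})$ be the closure in $H^1(\Gamma\cap B(\rho))$, and $H^1_{\mathsf w,0}(\Gamma\cap\overline{B^\complement(\rho)})$ the closure in $H^1_{\mathsf w}(\Gamma\cap B^\complement(\rho))$, of the set of restrictions of functions in $C^\infty_0(\Gamma)$ (smooth functions with compact support in $\Gamma$). Then the Kelvin transformation $$\mathcal K_\rho[u](X)=\Big(\frac{\rho}{|X|}\Big)^{n-2}u\Big(\Big(\frac{\rho}{|X|}\Big)^{2}X\Big)$$ associated with the reflection at the sphere of radius $\rho$ is an isomorphism (a bounded linear bijection with bounded inverse) from $H^1_0(\Gamma\cap\overline{B(\rho)})$ onto $H^1_{\mathsf w,0}(\Gamma\cap\overline{B^\complement(\rho)})$. -/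

import Mathlib

open MeasureTheory Set Filter
open scoped ENNReal ContDiff Topology

noncomputable section

namespace KelvinCone

/-- The Euclidean space `ℝⁿ`. -/
abbrev Rn (n : ℕ) : Type := EuclideanSpace ℝ (Fin n)

/-! ### Cones and capacity on the unit sphere -/

/-- `Γ` is an (infinite) open cone with vertex at the origin. -/
def IsOpenCone {n : ℕ} (Γ : Set (Rn n)) : Prop :=
  IsOpen Γ ∧ ∀ t : ℝ, 0 < t → ∀ x ∈ Γ, t • x ∈ Γ

/-- The section of `Γ` on the unit sphere. -/
def coneSection {n : ℕ} (Γ : Set (Rn n)) : Set (Metric.sphere (0 : Rn n) 1) :=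
  {θ | (θ : Rn n) ∈ Γ}

/-- The tangential gradient at a point `x` of the unit sphere of (the restriction to the sphere of)
a smooth function `v` on `ℝⁿ`. -/
def tangentialGradient {n : ℕ} (v : Rn n → ℝ) (x : Rn n) : Rn n :=
  gradient v x - inner ℝ x (gradient v x) • x

/-- The Sobolev `H¹`-capacity of a compact subset `A` of the unit sphere (relative to the sphere):
the infimum of the squared `H¹`-norms over the sphere of the smooth functions on the sphere
which are at least `1` in a neighbourhood of `A`. The smooth functions on the sphere are the
restrictions of the smooth functions on `ℝⁿ`. -/
def sphereCapacity {n : ℕ} (A : Set (Metric.sphere (0 : Rn n) 1)) : ℝ≥0∞ :=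
  ⨅ (v : Rn n → ℝ) (_ : ContDiff ℝ ∞ v)
    (_ : ∀ᶠ θ : Metric.sphere (0 : Rn n) 1 in 𝓝ˢ A, 1 ≤ v (θ : Rn n)),
    ∫⁻ θ : Metric.sphere (0 : Rn n) 1,
      ENNReal.ofReal (v (θ : Rn n) ^ 2 + ‖tangentialGradient v (θ : Rn n)‖ ^ 2)
        ∂(volume : Measure (Rn n)).toSphere

/-! ### Sobolev spaces -/

/-- Smooth functions on `ℝⁿ` with compact support contained in `U`. -/
def IsTestFunction {n : ℕ} (U : Set (Rn n)) (φ : Rn n → ℝ) : Prop :=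
  ContDiff ℝ ∞ φ ∧ HasCompactSupport φ ∧ tsupport φ ⊆ U

/-- `g` is the gradient of `u` in the sense of distributions in the open set `V`. -/
def IsWeakGradient {n : ℕ} (V : Set (Rn n)) (u : Rn n → ℝ) (g : Rn n → Rn n) : Prop :=
  LocallyIntegrableOn u V volume ∧ LocallyIntegrableOn g V volume ∧
    ∀ φ : Rn n → ℝ, IsTestFunction V φ →
      ∫ x in V, u x • gradient φ x = -∫ x in V, φ x • g x

/-- The measure `(1 + |x|)⁻² dx`. -/
def weightedVolume (n : ℕ) : Measure (Rn n) :=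
  volume.withDensity fun x => ENNReal.ofReal (((1 + ‖x‖) ^ 2)⁻¹)

theorem volume_ac_weightedVolume (n : ℕ) :
    (volume : Measure (Rn n)) ≪ weightedVolume n := by
  refine withDensity_absolutelyContinuous' (by fun_prop) (ae_of_all _ fun x => ?_)
  have : 1 + ‖x‖ ≠ 0 := by positivity
  simpa using this

theorem continuous_gradient {n : ℕ} {φ : Rn n → ℝ} (h : ContDiff ℝ ∞ φ) :
    Continuous (gradient φ) :=
  (InnerProductSpace.toDual ℝ (Rn n)).symm.continuous.comp (h.continuous_fderiv (by simp))

theorem integrableOn_smul_gradient {n : ℕ} {V : Set (Rn n)} {u φ : Rn n → ℝ}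
    (hu : LocallyIntegrableOn u V volume) (hφ : IsTestFunction V φ) :
    IntegrableOn (fun x => u x • gradient φ x) V volume := by
  obtain ⟨h1, h2, h3⟩ := hφ
  have h := (hu.integrableOn_compact_subset h3 h2).smul_continuousOn
    (continuous_gradient h1).continuousOn h2
  refine (IntegrableOn.integrable_of_forall_notMem_eq_zero h fun x hx => ?_).integrableOn
  have : fderiv ℝ φ x = 0 := by
    by_contra h0
    exact hx (support_fderiv_subset ℝ h0)
  simp [gradient, this]

theorem integrableOn_testFunction_smul {n : ℕ} {V : Set (Rn n)} {φ : Rn n → ℝ} {g : Rn n → Rn n}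
    (hg : LocallyIntegrableOn g V volume) (hφ : IsTestFunction V φ) :
    IntegrableOn (fun x => φ x • g x) V volume := by
  obtain ⟨h1, h2, h3⟩ := hφ
  have h := (hg.integrableOn_compact_subset h3 h2).continuousOn_smul
    h1.continuous.continuousOn h2
  refine (IntegrableOn.integrable_of_forall_notMem_eq_zero h fun x hx => ?_).integrableOn
  simp [image_eq_zero_of_notMem_tsupport hx]

theorem IsWeakGradient.congr {n : ℕ} {V : Set (Rn n)} {u u' : Rn n → ℝ} {g g' : Rn n → Rn n}
    (h : IsWeakGradient V u g) (hu : u =ᵐ[volume.restrict V] u')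
    (hg : g =ᵐ[volume.restrict V] g') : IsWeakGradient V u' g' := by
  have key : ∀ {F : Type} [NormedAddCommGroup F] {f f' : Rn n → F},
      LocallyIntegrableOn f V volume → f =ᵐ[volume.restrict V] f' →
        LocallyIntegrableOn f' V volume := by
    intro F _ f f' hf hff x hx
    obtain ⟨s, hs, hfs⟩ := hf x hx
    refine ⟨s ∩ V, inter_mem hs self_mem_nhdsWithin, ?_⟩
    exact (hfs.mono_set inter_subset_left).congr_fun_ae
      (ae_restrict_of_ae_restrict_of_subset inter_subset_right hff)
  refine ⟨key h.1 hu, key h.2.1 hg, fun φ hφ => ?_⟩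
  have h1 : ∫ x in V, u' x • gradient φ x = ∫ x in V, u x • gradient φ x :=
    integral_congr_ae (by filter_upwards [hu] with x hx; rw [hx])
  have h2 : ∫ x in V, φ x • g' x = ∫ x in V, φ x • g x :=
    integral_congr_ae (by filter_upwards [hg] with x hx; rw [hx])
  rw [h1, h2, h.2.2 φ hφ]

theorem IsWeakGradient.add {n : ℕ} {V : Set (Rn n)} {u u' : Rn n → ℝ} {g g' : Rn n → Rn n}
    (h : IsWeakGradient V u g) (h' : IsWeakGradient V u' g') :
    IsWeakGradient V (u + u') (g + g') := by
  refine ⟨h.1.add h'.1, h.2.1.add h'.2.1, fun φ hφ => ?_⟩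
  simp only [Pi.add_apply, add_smul, smul_add]
  rw [integral_add (integrableOn_smul_gradient h.1 hφ) (integrableOn_smul_gradient h'.1 hφ),
    integral_add (integrableOn_testFunction_smul h.2.1 hφ)
      (integrableOn_testFunction_smul h'.2.1 hφ), h.2.2 φ hφ, h'.2.2 φ hφ, neg_add]

theorem IsWeakGradient.smul {n : ℕ} {V : Set (Rn n)} {u : Rn n → ℝ} {g : Rn n → Rn n}
    (c : ℝ) (h : IsWeakGradient V u g) : IsWeakGradient V (c • u) (c • g) := by
  refine ⟨h.1.smul c, h.2.1.smul c, fun φ hφ => ?_⟩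
  have h1 : ∫ x in V, (c • u) x • gradient φ x = c • ∫ x in V, u x • gradient φ x := by
    rw [← integral_smul]
    simp [smul_smul]
  have h2 : ∫ x in V, φ x • (c • g) x = c • ∫ x in V, φ x • g x := by
    rw [← integral_smul]
    simp only [Pi.smul_apply, smul_comm c]
  rw [h1, h2, h.2.2 φ hφ, smul_neg]

theorem isWeakGradient_zero {n : ℕ} (V : Set (Rn n)) : IsWeakGradient V 0 0 :=
  ⟨locallyIntegrableOn_zero, locallyIntegrableOn_zero, fun φ _ => by simp⟩

/-- The space of the functions `u ∈ L²(V, ν)` whose distributional gradient in `V` belongs to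
`L²(V)`, with the norm `(‖u‖²_{L²(V, ν)} + ‖∇u‖²_{L²(V)})^{1/2}`. An element is the pair of (the
a.e.-class of) `u` and its gradient, which is determined by `u`. -/
def sobolev {n : ℕ} (V : Set (Rn n)) (ν : Measure (Rn n)) (hν : volume ≪ ν) :
    Submodule ℝ (WithLp 2 (Lp ℝ 2 (ν.restrict V) × Lp (Rn n) 2 (volume.restrict V))) where
  carrier := {f | IsWeakGradient V f.fst f.snd}
  zero_mem' := (isWeakGradient_zero V).congr
    ((hν.restrict V).ae_eq (Lp.coeFn_zero _ _ _).symm) (Lp.coeFn_zero _ _ _).symm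
  add_mem' := fun {f f'} h h' => (IsWeakGradient.add h h').congr
    ((hν.restrict V).ae_eq (Lp.coeFn_add f.fst f'.fst).symm) (Lp.coeFn_add f.snd f'.snd).symm
  smul_mem' := fun c f h => (IsWeakGradient.smul c h).congr
    ((hν.restrict V).ae_eq (Lp.coeFn_smul c f.fst).symm) (Lp.coeFn_smul c f.snd).symm

/-- The elements of `sobolev V ν` given by restrictions of smooth functions with compact support
in `U`. -/
def smoothPart {n : ℕ} (U V : Set (Rn n)) (ν : Measure (Rn n)) (hν : volume ≪ ν) :
    Submodule ℝ (sobolev V ν hν) where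
  carrier := {f | ∃ φ : Rn n → ℝ, IsTestFunction U φ ∧ f.1.fst =ᵐ[ν.restrict V] φ}
  zero_mem' := ⟨0, ⟨contDiff_const, HasCompactSupport.zero, by simp⟩, Lp.coeFn_zero _ _ _⟩
  add_mem' := by
    rintro f f' ⟨φ, hφ, h⟩ ⟨φ', hφ', h'⟩
    exact ⟨φ + φ', ⟨hφ.1.add hφ'.1, hφ.2.1.add hφ'.2.1,
      (tsupport_add φ φ').trans (union_subset hφ.2.2 hφ'.2.2)⟩,
      (Lp.coeFn_add f.1.fst f'.1.fst).trans (h.add h')⟩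
  smul_mem' := by
    rintro c f ⟨φ, hφ, h⟩
    exact ⟨c • φ, ⟨contDiff_const.smul hφ.1, hφ.2.1.smul_left,
      (closure_mono (Function.support_const_smul_subset c φ)).trans hφ.2.2⟩,
      (Lp.coeFn_smul c f.1.fst).trans (h.const_smul c)⟩

/-- `H¹(V)`. -/
abbrev H1 {n : ℕ} (V : Set (Rn n)) := sobolev V volume Measure.AbsolutelyContinuous.rfl

/-- The weighted space `H¹_w(V)`, with norm
`(∫_V |u|² (1 + |x|)⁻² dx + ∫_V |∇u|² dx)^{1/2}`. -/
abbrev H1w {n : ℕ} (V : Set (Rn n)) := sobolev V (weightedVolume n) (volume_ac_weightedVolume n)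

/-- The truncated cone `Γ ∩ B(ρ)`. -/
def innerCone {n : ℕ} (Γ : Set (Rn n)) (ρ : ℝ) : Set (Rn n) := Γ ∩ Metric.ball 0 ρ

/-- The truncated cone `Γ ∩ (ℝⁿ ∖ closed ball of radius ρ)`. -/
def outerCone {n : ℕ} (Γ : Set (Rn n)) (ρ : ℝ) : Set (Rn n) := Γ ∩ (Metric.closedBall 0 ρ)ᶜ

/-- `H¹₀(Γ ∩ closure B(ρ))`: the closure in `H¹(Γ ∩ B(ρ))` of the restrictions of the smooth
functions with compact support in `Γ` (no condition is imposed on the spherical part of the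
boundary). -/
def H10Inner {n : ℕ} (Γ : Set (Rn n)) (ρ : ℝ) : Submodule ℝ (H1 (innerCone Γ ρ)) :=
  (smoothPart Γ (innerCone Γ ρ) volume Measure.AbsolutelyContinuous.rfl).topologicalClosure

/-- `H¹_{w,0}(Γ ∩ closure Bᶜ(ρ))`: the closure in `H¹_w(Γ ∩ Bᶜ(ρ))` of the restrictions of the
smooth functions with compact support in `Γ`. -/
def H1w0Outer {n : ℕ} (Γ : Set (Rn n)) (ρ : ℝ) : Submodule ℝ (H1w (outerCone Γ ρ)) :=
  (smoothPart Γ (outerCone Γ ρ) (weightedVolume n)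
    (volume_ac_weightedVolume n)).topologicalClosure

/-! ### The Kelvin transformation -/

/-- The Kelvin transformation for the reflection at the unit sphere. -/
def kelvinUnit {n : ℕ} (u : Rn n → ℝ) : Rn n → ℝ :=
  fun X => ‖X‖ ^ ((2 : ℤ) - n) * u ((‖X‖ ^ 2)⁻¹ • X)

/-- The dilation operator. -/
def dilation {n : ℕ} (ρ : ℝ) (u : Rn n → ℝ) : Rn n → ℝ := fun x => u (ρ⁻¹ • x)

/-- The Kelvin transformation for the reflection at the sphere of radius `ρ`. -/
def kelvin {n : ℕ} (ρ : ℝ) (u : Rn n → ℝ) : Rn n → ℝ :=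
  dilation ρ (kelvinUnit (dilation ρ⁻¹ u))

end KelvinCone

end

/-!
The Kelvin transformation `K` exchanges test functions in `Γ` with test functions in `Γ`: a set of
positive capacity is nonempty, so `Γ` omits a point `θ` of the sphere, hence the whole ray through
`θ` and the origin, and `K` is an involution on functions that vanish at the origin. It remains to
bound the energies of `φ` on the inner and of `K φ` on the outer truncated cone by each other.

The inversion `I` is conformal with Jacobian `(ρ / |X|) ^ (2 n)`. Changing variables, the Dirichlet
integral of `K φ` is at most a combination of `∫ |∇φ|²` and `(n - 2)² ∫ φ² / |y|²`, and the weighted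
`L²`-norm of `K φ` is at most `∫ φ² / |y|²` (`setLIntegral_sq_norm_gradient_kelvin_le`,
`setLIntegral_mul_sq_kelvin`). Away from the origin the weight `|y|⁻²` is harmless, which gives
`exists_energy_kelvin_inner_le`. On the inner cone one needs Hardy's inequality
`∫ φ² / |y|² ≤ C (∫ φ² + ∫ |∇φ|²)` (`exists_hardy_ball`). For `n ≥ 3` it holds for all smooth
functions, ray by ray. For `n = 2` it fails in general, but test functions in `Γ` vanish on the ray
through `θ`, and it follows from the Poincaré inequality on circles.

To pass to the closures, consider the graph of `K` on test functions, `kelvinGraph`. Its two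
components control each other, and the Sobolev spaces are complete
(`LocallyDominatesVolume.completeSpace_sobolev`), so its closure is the graph of an isomorphism
between the closures of its projections (`exists_equiv_of_graph`). On the closure, the second
component still is the Kelvin transform of the first (`ae_eq_kelvin_of_mem_closure`).
-/

namespace KelvinCone

open EuclideanGeometry

/-! ### The Kelvin transformation and the inversion in a sphere -/

section Kelvin

variable {n : ℕ} {ρ : ℝ}

theorem kelvin_eq_zpow (hρ : 0 < ρ) (u : Rn n → ℝ) (X : Rn n) :
    kelvin ρ u X = (‖X‖ / ρ) ^ ((2 : ℤ) - n) * u (inversion 0 ρ X) := by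
  have h : (ρ⁻¹)⁻¹ • (‖ρ⁻¹ • X‖ ^ 2)⁻¹ • ρ⁻¹ • X = inversion 0 ρ X := by
    rcases eq_or_ne X 0 with rfl | hX
    · simp
    · have : ‖X‖ ≠ 0 := norm_ne_zero_iff.2 hX
      rw [inversion, dist_zero_right, vsub_eq_sub, sub_zero, vadd_eq_add, add_zero, smul_smul,
        smul_smul, norm_smul, norm_inv, Real.norm_of_nonneg hρ.le]
      congr 1
      field_simp
  simp only [kelvin, dilation, kelvinUnit, h]
  rw [norm_smul, norm_inv, Real.norm_of_nonneg hρ.le, inv_mul_eq_div]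

theorem kelvin_eq (hn : 2 ≤ n) (hρ : 0 < ρ) (u : Rn n → ℝ) {X : Rn n} (hX : X ≠ 0) :
    kelvin ρ u X = (ρ / ‖X‖) ^ (n - 2) * u (inversion 0 ρ X) := by
  have : ‖X‖ ≠ 0 := norm_ne_zero_iff.2 hX
  rw [kelvin_eq_zpow hρ, show (2 : ℤ) - n = -((n - 2 : ℕ) : ℤ) by omega, zpow_neg, zpow_natCast,
    ← inv_pow, inv_div]

theorem kelvin_add (hρ : 0 < ρ) (u v : Rn n → ℝ) :
    kelvin ρ (u + v) = kelvin ρ u + kelvin ρ v := by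
  ext X
  simp only [kelvin_eq_zpow hρ, Pi.add_apply, mul_add]

theorem kelvin_smul (hρ : 0 < ρ) (c : ℝ) (u : Rn n → ℝ) :
    kelvin ρ (c • u) = c • kelvin ρ u := by
  ext X
  simp only [kelvin_eq_zpow hρ, Pi.smul_apply, smul_eq_mul]
  ring

theorem kelvin_zero (hρ : 0 < ρ) : kelvin ρ (0 : Rn n → ℝ) = 0 := by
  ext X
  simp [kelvin_eq_zpow hρ]

theorem norm_inversion_zero (X : Rn n) : ‖inversion 0 ρ X‖ = ρ ^ 2 / ‖X‖ := by
  simpa using dist_inversion_center 0 X ρ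

theorem inversion_zero_ne_zero (hρ : 0 < ρ) {X : Rn n} (hX : X ≠ 0) :
    inversion 0 ρ X ≠ 0 := by
  rwa [Ne, inversion_eq_center hρ.ne']

/-- At the origin, `u 0 = 0` is needed: there `inversion 0 ρ` takes the junk value `0`. -/
theorem kelvin_kelvin (hn : 2 ≤ n) (hρ : 0 < ρ) {u : Rn n → ℝ} (hu : u 0 = 0) :
    kelvin ρ (kelvin ρ u) = u := by
  ext X
  rcases eq_or_ne X 0 with rfl | hX
  · simp [kelvin_eq_zpow hρ, hu]
  · have : ‖X‖ ≠ 0 := norm_ne_zero_iff.2 hX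
    rw [kelvin_eq hn hρ _ hX, kelvin_eq hn hρ _ (inversion_zero_ne_zero hρ hX),
      inversion_inversion 0 hρ.ne', norm_inversion_zero, ← mul_assoc, ← mul_pow]
    rw [show ρ / ‖X‖ * (ρ / (ρ ^ 2 / ‖X‖)) = 1 by field_simp, one_pow, one_mul]

/-- The derivative of the inversion is `(ρ / |X|) ^ 2` times a reflection. -/
theorem abs_det_fderiv_inversion (X : Rn n) :
    |((ρ / dist X 0) ^ 2 • ((ℝ ∙ (X - 0))ᗮ.reflection : Rn n →L[ℝ] Rn n)).det|
      = (ρ / ‖X‖) ^ (2 * n) := by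
  have h : (((ρ / dist X 0) ^ 2 • ((ℝ ∙ (X - 0))ᗮ.reflection : Rn n →L[ℝ] Rn n)) :
      Rn n →L[ℝ] Rn n).det = ((ρ / dist X 0) ^ 2) ^ Module.finrank ℝ (Rn n) *
        LinearMap.det (ℝ ∙ (X - 0))ᗮ.reflection.toLinearMap :=
    LinearMap.det_smul _ _
  rw [h, Submodule.det_reflection, abs_mul, abs_pow (-1 : ℝ)]
  simp only [abs_neg, abs_one, one_pow, mul_one, finrank_euclideanSpace, Fintype.card_fin,
    dist_zero_right]
  rw [abs_of_nonneg (by positivity), ← pow_mul]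

/-- Change of variables under the inversion in the sphere of radius `ρ`. -/
theorem setLIntegral_image_inversion (hρ : 0 < ρ) {V : Set (Rn n)} (hV : MeasurableSet V)
    (h0 : (0 : Rn n) ∉ V) (F : Rn n → ℝ≥0∞) :
    ∫⁻ y in inversion 0 ρ '' V, F y
      = ∫⁻ x in V, ENNReal.ofReal ((ρ / ‖x‖) ^ (2 * n)) * F (inversion 0 ρ x) := by
  rw [lintegral_image_eq_lintegral_abs_det_fderiv_mul volume hV
    (fun x hx => (hasFDerivAt_inversion (c := 0) (R := ρ)
      (ne_of_mem_of_not_mem hx h0)).hasFDerivWithinAt)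
    (inversion_injective 0 hρ.ne').injOn]
  exact lintegral_congr fun x => by rw [abs_det_fderiv_inversion]

/-- The inversion does not change null sets away from its centre. -/
theorem ae_comp_inversion (hρ : 0 < ρ) {V : Set (Rn n)} (hV : MeasurableSet V)
    (h0 : (0 : Rn n) ∉ V) {p : Rn n → Prop}
    (h : ∀ᵐ y ∂volume.restrict (inversion 0 ρ '' V), p y) :
    ∀ᵐ x ∂volume.restrict V, p (inversion 0 ρ x) := by
  obtain ⟨t, ht, htm, ht0⟩ := exists_measurable_superset_of_null h
  have h1 : ∫⁻ y in inversion 0 ρ '' V, t.indicator 1 y = 0 := by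
    rw [lintegral_indicator_one htm, ht0]
  have hm : Measurable (inversion (0 : Rn n) ρ) := by
    unfold inversion
    simp only [vsub_eq_sub, vadd_eq_add]
    fun_prop
  rw [setLIntegral_image_inversion hρ hV h0, lintegral_eq_zero_iff (by
    refine Measurable.mul (by fun_prop) ((measurable_one.indicator htm).comp hm))] at h1
  filter_upwards [h1, ae_restrict_mem hV] with x hx hxV
  by_contra hp
  have hxt : inversion 0 ρ x ∈ t := ht hp
  have hx0 : x ≠ 0 := ne_of_mem_of_not_mem hxV h0
  have : 0 < ‖x‖ := norm_pos_iff.2 hx0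
  simp only [hxt, indicator_of_mem, Pi.one_apply, mul_one, Pi.zero_apply,
    ENNReal.ofReal_eq_zero] at hx
  exact absurd hx (not_le.2 (by positivity))

theorem norm_gradient (φ : Rn n → ℝ) (x : Rn n) : ‖gradient φ x‖ = ‖fderiv ℝ φ x‖ := by
  simp [gradient]

/-- The factors in front of `u ∘ I` and its derivative combine, with the Jacobian
`(ρ / |X|) ^ (2 * n)` of the inversion `I`, to a bound by `∇u` and `u / |y|` at `y = I X`. -/
theorem sq_norm_gradient_kelvin_le (hn : 2 ≤ n) (hρ : 0 < ρ) {u : Rn n → ℝ}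
    (hu : Differentiable ℝ u) {X : Rn n} (hX : X ≠ 0) :
    ‖gradient (kelvin ρ u) X‖ ^ 2 ≤ (ρ / ‖X‖) ^ (2 * n) *
      (2 * ‖gradient u (inversion 0 ρ X)‖ ^ 2 +
        2 * (n - 2 : ℕ) ^ 2 * (u (inversion 0 ρ X) ^ 2 / ‖inversion 0 ρ X‖ ^ 2)) := by
  obtain ⟨m, rfl⟩ := Nat.exists_eq_add_of_le' hn
  rw [Nat.add_sub_cancel]
  have hX0 : 0 < ‖X‖ := norm_pos_iff.2 hX
  set Y := inversion 0 ρ X with hY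
  have hI := hasFDerivAt_inversion (c := 0) (R := ρ) hX
  set L : Rn (m + 2) →L[ℝ] Rn (m + 2) :=
    (ρ / dist X 0) ^ 2 • ((ℝ ∙ (X - 0))ᗮ.reflection : Rn (m + 2) →L[ℝ] Rn (m + 2)) with hL
  have hLn : ‖L‖ ≤ (ρ / ‖X‖) ^ 2 := by
    refine ContinuousLinearMap.opNorm_le_bound _ (by positivity) fun v => ?_
    simp only [hL, dist_zero_right, smul_apply, norm_smul]
    rw [Real.norm_of_nonneg (by positivity)]
    simp
  have h1 : HasFDerivAt (fun x => u (inversion 0 ρ x)) ((fderiv ℝ u Y).comp L) X :=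
    (hu Y).hasFDerivAt.comp X hI
  have hN : HasFDerivAt (fun x : Rn (m + 2) => ‖x‖) (fderiv ℝ (fun x => ‖x‖) X) X :=
    ((contDiffAt_norm ℝ hX (n := 1)).differentiableAt (by simp)).hasFDerivAt
  have hNn : ‖fderiv ℝ (fun x : Rn (m + 2) => ‖x‖) X‖ ≤ 1 := by
    simpa using norm_fderiv_le_of_lipschitz ℝ lipschitzWith_one_norm (x₀ := X)
  have hw0 : HasDerivAt (fun t : ℝ => (ρ / t) ^ m)
      (m * (ρ / ‖X‖) ^ (m - 1) * (ρ * (-(‖X‖ ^ 2)⁻¹))) ‖X‖ := by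
    simp only [div_eq_mul_inv]
    exact ((hasDerivAt_inv hX0.ne').const_mul ρ).pow m
  have hw := hw0.comp_hasFDerivAt X hN
  set w' := m * (ρ / ‖X‖) ^ (m - 1) * (ρ * (-(‖X‖ ^ 2)⁻¹)) with hw'
  have hw'n : |w'| = m * (ρ / ‖X‖) ^ m / ‖X‖ := by
    rw [hw', abs_mul, abs_mul, abs_mul, abs_neg, abs_of_pos hρ,
      abs_of_nonneg (by positivity : (0 : ℝ) ≤ (‖X‖ ^ 2)⁻¹),
      abs_of_nonneg (by positivity : (0 : ℝ) ≤ m),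
      abs_of_nonneg (by positivity : (0 : ℝ) ≤ (ρ / ‖X‖) ^ (m - 1))]
    rcases m with _ | k
    · simp
    · rw [Nat.add_sub_cancel]
      field_simp
      rw [pow_succ]
      field_simp
  have hK := hw.mul h1
  have hKe : kelvin ρ u =ᶠ[𝓝 X] ((fun t : ℝ => (ρ / t) ^ m) ∘ fun x => ‖x‖) *
      fun x => u (inversion 0 ρ x) := by
    filter_upwards [isOpen_ne.mem_nhds hX] with x hx
    rw [kelvin_eq hn hρ u hx]
    simp
  rw [norm_gradient, hKe.fderiv_eq, hK.fderiv, norm_gradient]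
  set a := ‖fderiv ℝ u Y‖
  set r := ρ / ‖X‖ with hr
  have hr0 : 0 < r := by positivity
  have hYn : ‖Y‖ = ρ * r := by rw [hY, norm_inversion_zero, hr]; ring
  have hb : ‖(((fun t : ℝ => (ρ / t) ^ m) ∘ fun x : Rn (m + 2) => ‖x‖) X) •
      (fderiv ℝ u Y).comp L + u (inversion 0 ρ X) •
        w' • fderiv ℝ (fun x : Rn (m + 2) => ‖x‖) X‖ ≤
      r ^ (m + 2) * (a + m * (|u Y| / ‖Y‖)) := by
    calc _ ≤ r ^ m * (a * r ^ 2) + |u Y| * ((m * r ^ m / ‖X‖) * 1) := by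
          refine (norm_add_le _ _).trans (add_le_add ?_ ?_)
          · rw [norm_smul]
            simp only [Function.comp_apply, ← hr]
            rw [Real.norm_of_nonneg (by positivity)]
            gcongr
            exact (ContinuousLinearMap.opNorm_comp_le _ _).trans (by gcongr)
          · rw [norm_smul, norm_smul, Real.norm_eq_abs, Real.norm_eq_abs, hw'n, ← hY]
            gcongr
      _ = _ := by
          rw [hYn, show ‖X‖ = ρ / r by rw [hr]; field_simp]
          field_simp
          ring
  calc _ ≤ (r ^ (m + 2) * (a + m * (|u Y| / ‖Y‖))) ^ 2 := by gcongr
    _ = r ^ (2 * (m + 2)) * (a + m * (|u Y| / ‖Y‖)) ^ 2 := by ring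
    _ ≤ _ := by
      gcongr
      have := two_mul_le_add_sq a (m * (|u Y| / ‖Y‖))
      have e : (m * (|u Y| / ‖Y‖)) ^ 2 = m ^ 2 * (u Y ^ 2 / ‖Y‖ ^ 2) := by
        rw [mul_pow, div_pow, sq_abs]
      nlinarith

theorem IsTestFunction.apply_eq_zero {U : Set (Rn n)} {φ : Rn n → ℝ} (hφ : IsTestFunction U φ)
    {x : Rn n} (hx : x ∉ U) : φ x = 0 :=
  image_eq_zero_of_notMem_tsupport fun h => hx (hφ.2.2 h)

theorem IsTestFunction.gradient_eq_zero {U : Set (Rn n)} {φ : Rn n → ℝ}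
    (hφ : IsTestFunction U φ) {x : Rn n} (hx : x ∉ U) : gradient φ x = 0 := by
  have : fderiv ℝ φ x = 0 := by
    by_contra h0
    exact hx (hφ.2.2 (support_fderiv_subset ℝ h0))
  simp [gradient, this]

theorem isTestFunction_zero {U : Set (Rn n)} : IsTestFunction U (0 : Rn n → ℝ) :=
  ⟨contDiff_const, HasCompactSupport.zero, by simp⟩

theorem IsTestFunction.add {U : Set (Rn n)} {φ ψ : Rn n → ℝ} (hφ : IsTestFunction U φ) (hψ : IsTestFunction U ψ) :
    IsTestFunction U (φ + ψ) :=
  ⟨hφ.1.add hψ.1, hφ.2.1.add hψ.2.1, (tsupport_add φ ψ).trans (union_subset hφ.2.2 hψ.2.2)⟩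

theorem IsTestFunction.smul {U : Set (Rn n)} {φ : Rn n → ℝ} (hφ : IsTestFunction U φ) (c : ℝ) :
    IsTestFunction U (c • φ) :=
  ⟨contDiff_const.smul hφ.1, hφ.2.1.smul_left,
    (closure_mono (Function.support_const_smul_subset c φ)).trans hφ.2.2⟩

theorem IsOpenCone.inversion_mem {Γ : Set (Rn n)} (hΓ : IsOpenCone Γ) (hρ : 0 < ρ) {x : Rn n}
    (hx : x ∈ Γ) (h0 : (0 : Rn n) ∉ Γ) : inversion 0 ρ x ∈ Γ := by
  have hx0 : 0 < ‖x‖ := norm_pos_iff.2 (ne_of_mem_of_not_mem hx h0)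
  simpa [inversion] using hΓ.2 ((ρ / ‖x‖) ^ 2) (by positivity) x hx

/-- A test function in a cone without the origin vanishes near the origin and near infinity, and
the inversion exchanges the two. -/
theorem IsTestFunction.kelvin {Γ : Set (Rn n)} (hΓ : IsOpenCone Γ) (h0 : (0 : Rn n) ∉ Γ)
    (hn : 2 ≤ n) (hρ : 0 < ρ) {φ : Rn n → ℝ} (hφ : IsTestFunction Γ φ) :
    IsTestFunction Γ (kelvin ρ φ) := by
  have hne : ∀ x ∈ tsupport φ, x ≠ 0 := fun x hx => ne_of_mem_of_not_mem (hφ.2.2 hx) h0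
  set K := inversion 0 ρ '' tsupport φ with hK
  have hKc : IsCompact K := hφ.2.1.isCompact.image_of_continuousOn
    (continuousOn_const.inversion continuousOn_const continuousOn_id hne)
  have hKΓ : K ⊆ Γ := by
    rintro _ ⟨x, hx, rfl⟩
    exact hΓ.inversion_mem hρ (hφ.2.2 hx) h0
  have hz : ∀ x ∉ K, KelvinCone.kelvin ρ φ x = 0 := by
    intro x hx
    rw [kelvin_eq_zpow hρ, image_eq_zero_of_notMem_tsupport (f := φ), mul_zero]
    exact fun h => hx ⟨_, h, inversion_inversion 0 hρ.ne' x⟩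
  have hsupp : tsupport (KelvinCone.kelvin ρ φ) ⊆ K :=
    closure_minimal (fun x hx => by_contra fun h => hx (hz x h)) hKc.isClosed
  refine ⟨contDiff_iff_contDiffAt.2 fun X => ?_, HasCompactSupport.intro hKc hz, hsupp.trans hKΓ⟩
  rcases eq_or_ne X 0 with rfl | hX
  · have : (0 : Rn n) ∈ Kᶜ := fun h => h0 (hKΓ h)
    exact contDiffAt_const.congr_of_eventuallyEq (f := fun _ => (0 : ℝ))
      (by filter_upwards [hKc.isClosed.isOpen_compl.mem_nhds this] with x hx using hz x hx)
  · have h1 : ContDiffAt ℝ ∞ (fun x : Rn n => (ρ / ‖x‖) ^ (n - 2) * φ (inversion 0 ρ x)) X := by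
      refine ((contDiffAt_const.div (contDiffAt_norm ℝ hX) (norm_ne_zero_iff.2 hX)).pow _).mul ?_
      exact hφ.1.contDiffAt.comp X
        (contDiffAt_const.inversion contDiffAt_const contDiffAt_id hX)
    refine h1.congr_of_eventuallyEq ?_
    filter_upwards [isOpen_ne.mem_nhds hX] with x hx using kelvin_eq hn hρ φ hx

theorem image_inversion_outerCone {Γ : Set (Rn n)} (hΓ : IsOpenCone Γ) (h0 : (0 : Rn n) ∉ Γ)
    (hρ : 0 < ρ) : inversion 0 ρ '' outerCone Γ ρ = innerCone Γ ρ := by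
  rw [image_eq_preimage_of_inverse (inversion_involutive 0 hρ.ne').leftInverse
    (inversion_involutive 0 hρ.ne').rightInverse]
  ext x
  have hΓx : inversion 0 ρ x ∈ Γ ↔ x ∈ Γ :=
    ⟨fun h => by simpa [inversion_inversion _ hρ.ne'] using hΓ.inversion_mem hρ h h0,
      fun h => hΓ.inversion_mem hρ h h0⟩
  simp only [outerCone, innerCone, mem_preimage, mem_inter_iff, hΓx, mem_compl_iff,
    mem_closedBall_zero_iff, mem_ball_zero_iff, norm_inversion_zero, not_le]
  refine and_congr_right fun hx => ?_
  have hx0 : 0 < ‖x‖ := norm_pos_iff.2 (ne_of_mem_of_not_mem hx h0)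
  rw [lt_div_iff₀ hx0, pow_two, mul_lt_mul_iff_right₀ hρ]

theorem image_inversion_innerCone {Γ : Set (Rn n)} (hΓ : IsOpenCone Γ) (h0 : (0 : Rn n) ∉ Γ)
    (hρ : 0 < ρ) : inversion 0 ρ '' innerCone Γ ρ = outerCone Γ ρ := by
  rw [← image_inversion_outerCone hΓ h0 hρ, image_image]
  simp [inversion_inversion _ hρ.ne']

theorem isOpen_innerCone {Γ : Set (Rn n)} (hΓ : IsOpenCone Γ) : IsOpen (innerCone Γ ρ) :=
  hΓ.1.inter Metric.isOpen_ball

theorem isOpen_outerCone {Γ : Set (Rn n)} (hΓ : IsOpenCone Γ) : IsOpen (outerCone Γ ρ) :=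
  hΓ.1.inter Metric.isClosed_closedBall.isOpen_compl

/-- The integral of `|K u|²` with a weight `m`, after the change of variables `y = I x`. -/
theorem setLIntegral_mul_sq_kelvin (hn : 2 ≤ n) (hρ : 0 < ρ) {V : Set (Rn n)}
    (hV : MeasurableSet V) (h0 : (0 : Rn n) ∉ V) (u m : Rn n → ℝ) (hm : ∀ x, 0 ≤ m x) :
    ∫⁻ x in V, ENNReal.ofReal (m x * kelvin ρ u x ^ 2)
      = ∫⁻ y in inversion 0 ρ '' V,
          ENNReal.ofReal (m (inversion 0 ρ y) * (ρ / ‖y‖) ^ 4 * u y ^ 2) := by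
  rw [setLIntegral_image_inversion hρ hV h0]
  refine setLIntegral_congr_fun hV fun x hx => ?_
  have hx0 : x ≠ 0 := ne_of_mem_of_not_mem hx h0
  have hx1 : 0 < ‖x‖ := norm_pos_iff.2 hx0
  rw [← ENNReal.ofReal_mul (by positivity), inversion_inversion 0 hρ.ne', kelvin_eq hn hρ u hx0,
    norm_inversion_zero]
  obtain ⟨k, rfl⟩ := Nat.exists_eq_add_of_le' hn
  rw [Nat.add_sub_cancel, show 2 * (k + 2) = 2 * k + 4 by ring, pow_add (ρ / ‖x‖), pow_mul']
  congr 1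
  field_simp

/-- The Dirichlet integral of `K u`, after the change of variables `y = I x`. -/
theorem setLIntegral_sq_norm_gradient_kelvin_le (hn : 2 ≤ n) (hρ : 0 < ρ) {V : Set (Rn n)}
    (hV : MeasurableSet V) (h0 : (0 : Rn n) ∉ V) {u : Rn n → ℝ} (hu : Differentiable ℝ u) :
    ∫⁻ x in V, ENNReal.ofReal (‖gradient (kelvin ρ u) x‖ ^ 2)
      ≤ ∫⁻ y in inversion 0 ρ '' V, ENNReal.ofReal (2 * ‖gradient u y‖ ^ 2 +
          2 * (n - 2 : ℕ) ^ 2 * (u y ^ 2 / ‖y‖ ^ 2)) := by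
  rw [setLIntegral_image_inversion hρ hV h0]
  refine setLIntegral_mono' hV fun x hx => ?_
  rw [← ENNReal.ofReal_mul (by positivity)]
  exact ENNReal.ofReal_le_ofReal
    (sq_norm_gradient_kelvin_le hn hρ hu (ne_of_mem_of_not_mem hx h0))

end Kelvin

/-! ### One-dimensional inequalities -/

/-- The radial Hardy inequality on `(0, ρ)`. The weight `r ^ (m + 1) * (1 - r ^ 2 / ρ ^ 2)`
vanishes at both ends, so that integrating the derivative of its product with `f ^ 2` leaves no
boundary terms. -/
theorem integral_pow_mul_sq_le (m : ℕ) {ρ : ℝ} (hρ : 0 < ρ) {f f' : ℝ → ℝ}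
    (hf : ∀ r, HasDerivAt f (f' r) r) (hf' : Continuous f') :
    ∫ r in (0 : ℝ)..ρ, r ^ m * f r ^ 2
      ≤ (4 + 2 * (m + 3) / ρ ^ 2) * ∫ r in (0 : ℝ)..ρ, r ^ (m + 2) * (f r ^ 2 + f' r ^ 2) := by
  have hfc : Continuous f := continuous_iff_continuousAt.2 fun r => (hf r).continuousAt
  set F' : ℝ → ℝ := fun r => ((m + 1 : ℕ) * r ^ m * (1 - r ^ 2 / ρ ^ 2) +
    r ^ (m + 1) * (-(2 * r / ρ ^ 2))) * f r ^ 2 +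
      r ^ (m + 1) * (1 - r ^ 2 / ρ ^ 2) * (2 * f r * f' r) with hF'
  have hd : ∀ r, HasDerivAt (fun r => r ^ (m + 1) * (1 - r ^ 2 / ρ ^ 2) * f r ^ 2) (F' r) r := by
    intro r
    have h1 : HasDerivAt (fun r : ℝ => r ^ (m + 1)) ((m + 1 : ℕ) * r ^ m) r := by
      simpa using hasDerivAt_pow (m + 1) r
    have h2 : HasDerivAt (fun r : ℝ => 1 - r ^ 2 / ρ ^ 2) (-(2 * r / ρ ^ 2)) r := by
      simpa using ((hasDerivAt_pow 2 r).div_const (ρ ^ 2)).const_sub 1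
    have h3 : HasDerivAt (fun r : ℝ => f r ^ 2) (2 * f r * f' r) r := by
      simpa using (hf r).fun_pow 2
    exact (h1.mul h2).mul h3
  have hF'c : Continuous F' := by fun_prop
  have h0 : ∫ r in (0 : ℝ)..ρ, F' r = 0 := by
    rw [intervalIntegral.integral_eq_sub_of_hasDerivAt (fun r _ => hd r)
      (hF'c.intervalIntegrable _ _)]
    simp [hρ.ne']
  have hpt : ∀ r ∈ Icc 0 ρ, r ^ m * f r ^ 2 ≤
      2 * F' r + (4 + 2 * (m + 3) / ρ ^ 2) * (r ^ (m + 2) * (f r ^ 2 + f' r ^ 2)) := by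
    rintro r ⟨hr0, hr1⟩
    set s := 1 - r ^ 2 / ρ ^ 2 with hs
    have hs1 : s ≤ 1 := by
      have : 0 ≤ r ^ 2 / ρ ^ 2 := by positivity
      linarith
    have hs0 : 0 ≤ s := by
      have : r ^ 2 / ρ ^ 2 ≤ 1 := by
        rw [div_le_one (by positivity)]
        gcongr
      linarith
    -- The difference of the two sides is a sum of squares with nonnegative coefficients.
    have e : 2 * F' r + (4 + 2 * (m + 3) / ρ ^ 2) * (r ^ (m + 2) * (f r ^ 2 + f' r ^ 2))
        - r ^ m * f r ^ 2 = r ^ m * (2 * m * f r ^ 2 + (f r + 2 * (r * s * f' r)) ^ 2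
          + 4 * (r * f' r) ^ 2 * (1 - s ^ 2) + 4 * (r * f r) ^ 2
          + 2 * (m + 3) / ρ ^ 2 * (r * f' r) ^ 2) := by
      simp only [hF', ← hs]
      have : (((m + 1 : ℕ) : ℝ) * r ^ m * s + r ^ (m + 1) * (-(2 * r / ρ ^ 2)))
          = r ^ m * ((m + 1) - (m + 3) * r ^ 2 / ρ ^ 2) := by
        rw [hs]; push_cast; ring
      rw [this]
      ring
    have h4 : 0 ≤ 1 - s ^ 2 := by nlinarith
    have : 0 ≤ r ^ m * (2 * m * f r ^ 2 + (f r + 2 * (r * s * f' r)) ^ 2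
          + 4 * (r * f' r) ^ 2 * (1 - s ^ 2) + 4 * (r * f r) ^ 2
          + 2 * (m + 3) / ρ ^ 2 * (r * f' r) ^ 2) := by positivity
    linarith
  calc ∫ r in (0 : ℝ)..ρ, r ^ m * f r ^ 2
      ≤ ∫ r in (0 : ℝ)..ρ, (2 * F' r +
          (4 + 2 * (m + 3) / ρ ^ 2) * (r ^ (m + 2) * (f r ^ 2 + f' r ^ 2))) :=
        intervalIntegral.integral_mono_on hρ.le (Continuous.intervalIntegrable (by fun_prop) _ _)
          (Continuous.intervalIntegrable (by fun_prop) _ _) hpt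
    _ = _ := by
        rw [intervalIntegral.integral_add (Continuous.intervalIntegrable (by fun_prop) _ _)
          (Continuous.intervalIntegrable (by fun_prop) _ _),
          intervalIntegral.integral_const_mul, intervalIntegral.integral_const_mul, h0]
        ring

/-- The Poincaré inequality on an interval, for functions with a zero. -/
theorem integral_sq_le_of_zero {a b c : ℝ} (hc : c ∈ Icc a b) {g g' : ℝ → ℝ}
    (hg : ∀ t, HasDerivAt g (g' t) t) (hg' : Continuous g') (h0 : g c = 0) :
    ∫ t in a..b, g t ^ 2 ≤ (b - a) ^ 2 * ∫ t in a..b, g' t ^ 2 := by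
  have hab : a ≤ b := hc.1.trans hc.2
  have hgc : Continuous g := continuous_iff_continuousAt.2 fun r => (hg r).continuousAt
  set M := ∫ t in a..b, |g' t| with hM
  have hint : ∀ {h : ℝ → ℝ}, Continuous h → ∀ x y, IntervalIntegrable h volume x y :=
    fun h x y => h.intervalIntegrable x y
  have h1 : ∀ t ∈ Icc a b, |g t| ≤ M := by
    intro t ht
    have : g t = ∫ s in c..t, g' s := by
      rw [intervalIntegral.integral_eq_sub_of_hasDerivAt (fun r _ => hg r) (hint hg' _ _), h0,
        sub_zero]
    rw [this, ← Real.norm_eq_abs, hM, intervalIntegral.integral_of_le hab]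
    refine intervalIntegral.norm_integral_le_integral_norm_uIoc.trans ?_
    refine setIntegral_mono_set ((hint (by fun_prop) a b : IntervalIntegrable (fun t => |g' t|)
      volume a b).1) (ae_of_all _ fun _ => abs_nonneg _) (LE.le.eventuallyLE ?_)
    exact Ioc_subset_Ioc (le_min hc.1 ht.1) (max_le hc.2 ht.2)
  have hM0 : 0 ≤ M := intervalIntegral.integral_nonneg hab fun _ _ => abs_nonneg _
  have h2 : ∫ t in a..b, g t ^ 2 ≤ (b - a) * M ^ 2 := by
    calc ∫ t in a..b, g t ^ 2 ≤ ∫ _ in a..b, M ^ 2 :=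
          intervalIntegral.integral_mono_on hab (hint (by fun_prop) _ _)
            (hint (by fun_prop) _ _) fun t ht => by
              rw [← sq_abs (g t)]
              have := h1 t ht
              gcongr
      _ = _ := by simp
  -- The variance of `|g'|` is nonnegative.
  have h3 : 0 ≤ ∫ t in a..b, ((b - a) * |g' t| - M) ^ 2 :=
    intervalIntegral.integral_nonneg hab fun _ _ => sq_nonneg _
  have h4 : ∫ t in a..b, ((b - a) * |g' t| - M) ^ 2
      = (b - a) ^ 2 * (∫ t in a..b, g' t ^ 2) - (b - a) * M ^ 2 := by
    have : ∀ t, ((b - a) * |g' t| - M) ^ 2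
        = (b - a) ^ 2 * g' t ^ 2 - (2 * (b - a) * M) * |g' t| + M ^ 2 := fun t => by
      rw [← sq_abs (g' t)]; ring
    simp_rw [this]
    rw [intervalIntegral.integral_add (hint (by fun_prop) _ _) (hint (by fun_prop) _ _),
      intervalIntegral.integral_sub (hint (by fun_prop) _ _) (hint (by fun_prop) _ _),
      intervalIntegral.integral_const_mul, intervalIntegral.integral_const_mul,
      intervalIntegral.integral_const, smul_eq_mul, ← hM]
    ring
  linarith

theorem lintegral_Ioo_ofReal {a b : ℝ} (hab : a ≤ b) {f : ℝ → ℝ} (hf : Continuous f)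
    (h0 : ∀ t ∈ Ioo a b, 0 ≤ f t) :
    ∫⁻ t in Ioo a b, ENNReal.ofReal (f t) = ENNReal.ofReal (∫ t in a..b, f t) := by
  rw [intervalIntegral.integral_of_le hab, integral_Ioc_eq_integral_Ioo,
    ofReal_integral_eq_lintegral_ofReal]
  · exact (hf.intervalIntegrable a b).1.mono_set Ioo_subset_Ioc_self
  · filter_upwards [ae_restrict_mem measurableSet_Ioo] with t ht using h0 t ht

/-! ### Hardy's inequality on balls -/

/-- Integration in polar coordinates. -/
theorem lintegral_ball_polar {n : ℕ} [Nontrivial (Rn n)] (ρ : ℝ) {F : Rn n → ℝ≥0∞}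
    (hF : Measurable F) :
    ∫⁻ x in Metric.ball 0 ρ, F x = ∫⁻ θ : Metric.sphere (0 : Rn n) 1, (∫⁻ r in Ioo 0 ρ,
      ENNReal.ofReal (r ^ (n - 1)) * F (r • (θ : Rn n))) ∂volume.toSphere := by
  set G := (Metric.ball (0 : Rn n) ρ).indicator F with hG
  have hGm : Measurable G := hF.indicator measurableSet_ball
  have h1 : ∫⁻ x in Metric.ball 0 ρ, F x =
      ∫⁻ x : ({0}ᶜ : Set (Rn n)), G x ∂(Measure.comap Subtype.val volume) := by
    rw [lintegral_subtype_comap (measurableSet_singleton _).compl, restrict_compl_singleton, hG,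
      lintegral_indicator measurableSet_ball]
  rw [h1]
  have hmp := (volume : Measure (Rn n)).measurePreserving_homeomorphUnitSphereProd
  have key := hmp.lintegral_comp_emb (Homeomorph.measurableEmbedding _)
    (fun p => G ((p.2 : ℝ) • (p.1 : Rn n)))
  have e : ∀ x : ({0}ᶜ : Set (Rn n)), (((homeomorphUnitSphereProd (Rn n) x).2 : ℝ) •
      ((homeomorphUnitSphereProd (Rn n) x).1 : Rn n)) = x := by
    intro x
    have : ‖(x : Rn n)‖ ≠ 0 := norm_ne_zero_iff.2 x.2
    simp [smul_smul, this]
  simp only [e] at key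
  rw [key, lintegral_prod _ (by fun_prop)]
  refine lintegral_congr fun θ => ?_
  rw [Measure.volumeIoiPow, lintegral_withDensity_eq_lintegral_mul _ (by fun_prop) (by fun_prop),
    finrank_euclideanSpace, Fintype.card_fin]
  simp only [Pi.mul_apply]
  rw [lintegral_subtype_comap measurableSet_Ioi
    (fun r : ℝ => ENNReal.ofReal (r ^ (n - 1)) * G (r • (θ : Rn n))),
    ← Ioi_inter_Iio (a := 0) (b := ρ), inter_comm (Ioi 0), ← Measure.restrict_restrict measurableSet_Iio,
    ← lintegral_indicator measurableSet_Iio]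
  refine setLIntegral_congr_fun measurableSet_Ioi fun r (hr : 0 < r) => ?_
  have hθ : ‖(θ : Rn n)‖ = 1 := by simp
  by_cases h : r < ρ
  · have : r • (θ : Rn n) ∈ Metric.ball 0 ρ := by simpa [norm_smul, abs_of_pos hr] using h
    simp [hG, h, this]
  · have : r • (θ : Rn n) ∉ Metric.ball 0 ρ := by simpa [norm_smul, abs_of_pos hr] using h
    simp [hG, h, this]

theorem abs_fderiv_apply_le {n : ℕ} (φ : Rn n → ℝ) (x v : Rn n) :
    |fderiv ℝ φ x v| ≤ ‖v‖ * ‖gradient φ x‖ := by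
  rw [norm_gradient, ← Real.norm_eq_abs, mul_comm]
  exact (fderiv ℝ φ x).le_opNorm v

/-- In dimension at least three, Hardy's inequality on a ball follows from the radial inequality on
each ray, without any boundary condition. -/
theorem hardy_ball_of_three_le {n : ℕ} (hn : 3 ≤ n) {ρ : ℝ} (hρ : 0 < ρ) {φ : Rn n → ℝ}
    (hφ : ContDiff ℝ ∞ φ) :
    ∫⁻ x in Metric.ball 0 ρ, ENNReal.ofReal (φ x ^ 2 / ‖x‖ ^ 2)
      ≤ ENNReal.ofReal (4 + 2 * n / ρ ^ 2) *
        ∫⁻ x in Metric.ball 0 ρ, ENNReal.ofReal (φ x ^ 2 + ‖gradient φ x‖ ^ 2) := by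
  obtain ⟨m, rfl⟩ := Nat.exists_eq_add_of_le' hn
  have hgc := continuous_gradient hφ
  have hφc := hφ.continuous
  have hC : 0 ≤ 4 + 2 * ((m + 3 : ℕ) : ℝ) / ρ ^ 2 := by positivity
  rw [lintegral_ball_polar _ (by fun_prop), lintegral_ball_polar _ (by fun_prop),
    ← lintegral_const_mul' _ _ ENNReal.ofReal_ne_top]
  refine lintegral_mono fun θ => ?_
  rw [← lintegral_const_mul' _ _ ENNReal.ofReal_ne_top]
  have hθ : ‖(θ : Rn (m + 3))‖ = 1 := by simp
  set f : ℝ → ℝ := fun r => φ (r • (θ : Rn (m + 3))) with hf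
  set f' : ℝ → ℝ := fun r => fderiv ℝ φ (r • (θ : Rn (m + 3))) θ with hf'
  have hd : ∀ r, HasDerivAt f (f' r) r := fun r => by
    have h1 : HasDerivAt (fun r : ℝ => r • (θ : Rn (m + 3))) (θ : Rn (m + 3)) r := by
      simpa using (hasDerivAt_id r).smul_const (θ : Rn (m + 3))
    exact ((hφ.differentiable (by simp)) _).hasFDerivAt.comp_hasDerivAt r h1
  have hf'c : Continuous f' := by
    have := hφ.continuous_fderiv (by simp)
    fun_prop
  have hfc : Continuous f := by fun_prop
  calc _ = ∫⁻ r in Ioo 0 ρ, ENNReal.ofReal (r ^ m * f r ^ 2) := by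
        refine setLIntegral_congr_fun measurableSet_Ioo fun r hr => ?_
        have hr0 : 0 < r := hr.1
        rw [← ENNReal.ofReal_mul (by positivity), norm_smul, hθ, Real.norm_of_nonneg hr0.le,
          Nat.add_sub_assoc (by norm_num)]
        congr 1
        simp only [hf]
        norm_num
        rw [pow_add]
        field_simp
    _ = ENNReal.ofReal (∫ r in (0 : ℝ)..ρ, r ^ m * f r ^ 2) :=
        lintegral_Ioo_ofReal hρ.le (by fun_prop) fun r hr => by
          have := hr.1
          positivity
    _ ≤ ENNReal.ofReal ((4 + 2 * ((m + 3 : ℕ) : ℝ) / ρ ^ 2) *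
          ∫ r in (0 : ℝ)..ρ, r ^ (m + 2) * (f r ^ 2 + f' r ^ 2)) := by
        refine ENNReal.ofReal_le_ofReal ?_
        push_cast
        exact integral_pow_mul_sq_le m hρ hd hf'c
    _ = ∫⁻ r in Ioo 0 ρ, ENNReal.ofReal (4 + 2 * ((m + 3 : ℕ) : ℝ) / ρ ^ 2) *
          ENNReal.ofReal (r ^ (m + 2) * (f r ^ 2 + f' r ^ 2)) := by
        rw [ENNReal.ofReal_mul hC, lintegral_const_mul' _ _ ENNReal.ofReal_ne_top,
          lintegral_Ioo_ofReal hρ.le (by fun_prop) fun r hr => by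
            have := hr.1
            positivity]
    _ ≤ _ := by
        refine setLIntegral_mono' measurableSet_Ioo fun r hr => ?_
        have hr0 : 0 < r := hr.1
        rw [← ENNReal.ofReal_mul (by positivity : (0 : ℝ) ≤ r ^ (m + 3 - 1))]
        have h1 := abs_fderiv_apply_le φ (r • (θ : Rn (m + 3))) θ
        rw [hθ, one_mul] at h1
        have h2 : f' r ^ 2 ≤ ‖gradient φ (r • (θ : Rn (m + 3)))‖ ^ 2 := by
          rw [← sq_abs]
          gcongr
        rw [show m + 3 - 1 = m + 2 from rfl]
        gcongr

/-- Integration in planar polar coordinates. -/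
theorem lintegral_ball_polar_two (ρ : ℝ) {F : Rn 2 → ℝ≥0∞} (hF : Measurable F) :
    ∫⁻ x in Metric.ball 0 ρ, F x = ∫⁻ r in Ioo 0 ρ, ∫⁻ t in Ioo (-Real.pi) Real.pi,
      ENNReal.ofReal r *
        F (Complex.orthonormalBasisOneI.repr (r * (Real.cos t + Real.sin t * Complex.I))) := by
  set e := Complex.orthonormalBasisOneI.repr
  set G := (Metric.ball (0 : Rn 2) ρ).indicator F with hG
  have hGm : Measurable G := hF.indicator measurableSet_ball
  rw [← lintegral_indicator measurableSet_ball, ← hG,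
    ← e.measurePreserving.lintegral_comp hGm, ← Complex.lintegral_comp_polarCoord_symm,
    polarCoord_target, Measure.volume_eq_prod, ← Measure.prod_restrict, lintegral_prod _ (by
      simp only [Complex.polarCoord_symm_apply, smul_eq_mul]
      have : Measurable fun p : ℝ × ℝ =>
          e (p.1 * (Real.cos p.2 + Real.sin p.2 * Complex.I)) := by fun_prop
      exact ((by fun_prop : Measurable fun p : ℝ × ℝ => ENNReal.ofReal p.1).mul
        (hGm.comp this)).aemeasurable), ← Ioi_inter_Iio (a := 0) (b := ρ), inter_comm (Ioi 0),
    ← Measure.restrict_restrict measurableSet_Iio, ← lintegral_indicator measurableSet_Iio]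
  refine setLIntegral_congr_fun measurableSet_Ioi fun r (hr : 0 < r) => ?_
  simp only [Complex.polarCoord_symm_apply, smul_eq_mul]
  have hnorm : ∀ t, ‖e (r * (Real.cos t + Real.sin t * Complex.I))‖ = r := fun t => by
    rw [e.norm_map, ← Complex.polarCoord_symm_apply (r, t), Complex.norm_polarCoord_symm,
      abs_of_pos hr]
  by_cases h : r < ρ
  · have : ∀ t, e (r * (Real.cos t + Real.sin t * Complex.I)) ∈ Metric.ball 0 ρ := fun t => by
      rwa [mem_ball_zero_iff, hnorm]
    simp only [hG, mem_Iio, h, indicator_of_mem, this]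
  · have : ∀ t, e (r * (Real.cos t + Real.sin t * Complex.I)) ∉ Metric.ball 0 ρ := fun t => by
      rwa [mem_ball_zero_iff, hnorm]
    simp only [hG, mem_Iio, h, not_false_eq_true, indicator_of_notMem, this, mul_zero,
      lintegral_zero]

/-- In the plane, Hardy's inequality holds for functions that vanish on a ray: it follows from
the Poincaré inequality on circles. -/
theorem hardy_ball_two {ρ : ℝ} {φ : Rn 2 → ℝ} (hφ : ContDiff ℝ ∞ φ) {θ₀ : Rn 2}
    (hθ₀ : ‖θ₀‖ = 1) (h0 : ∀ r : ℝ, 0 < r → φ (r • θ₀) = 0) :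
    ∫⁻ x in Metric.ball 0 ρ, ENNReal.ofReal (φ x ^ 2 / ‖x‖ ^ 2)
      ≤ ENNReal.ofReal ((2 * Real.pi) ^ 2) *
        ∫⁻ x in Metric.ball 0 ρ, ENNReal.ofReal (φ x ^ 2 + ‖gradient φ x‖ ^ 2) := by
  have hgc := continuous_gradient hφ
  have hφc := hφ.continuous
  rw [lintegral_ball_polar_two _ (by fun_prop), lintegral_ball_polar_two _ (by fun_prop),
    ← lintegral_const_mul' _ _ ENNReal.ofReal_ne_top]
  refine setLIntegral_mono' measurableSet_Ioo fun r hr => ?_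
  have hr0 : 0 < r := hr.1
  rw [lintegral_const_mul' _ _ ENNReal.ofReal_ne_top, lintegral_const_mul' _ _ ENNReal.ofReal_ne_top,
    mul_left_comm]
  gcongr
  set e := Complex.orthonormalBasisOneI.repr with he
  set γ : ℝ → Rn 2 := fun t => e (r * (Real.cos t + Real.sin t * Complex.I)) with hγ
  set γ' : ℝ → Rn 2 := fun t => e (r * (-Real.sin t + Real.cos t * Complex.I)) with hγ'
  have hγn : ∀ t, ‖γ t‖ = r := fun t => by
    rw [hγ, e.norm_map, ← Complex.polarCoord_symm_apply (r, t), Complex.norm_polarCoord_symm,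
      abs_of_pos hr0]
  have hγ'n : ∀ t, ‖γ' t‖ = r := fun t => by
    rw [← hγn (t + Real.pi / 2), hγ, hγ']
    simp [Real.cos_add_pi_div_two, Real.sin_add_pi_div_two]
  have hγd : ∀ t, HasDerivAt γ (γ' t) t := fun t => by
    have h1 : HasDerivAt (fun t : ℝ => (r : ℂ) * (Real.cos t + Real.sin t * Complex.I))
        (r * (-Real.sin t + Real.cos t * Complex.I)) t := by
      have hc : HasDerivAt (fun t : ℝ => ((Real.cos t : ℝ) : ℂ)) (-Real.sin t : ℂ) t := by
        simpa using (Real.hasDerivAt_cos t).ofReal_comp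
      have hs : HasDerivAt (fun t : ℝ => ((Real.sin t : ℝ) : ℂ)) (Real.cos t : ℂ) t :=
        (Real.hasDerivAt_sin t).ofReal_comp
      exact (hc.add (hs.mul_const Complex.I)).const_mul (r : ℂ)
    exact (e.toContinuousLinearEquiv : ℂ →L[ℝ] Rn 2).hasFDerivAt.comp_hasDerivAt t h1
  have hγc : Continuous γ := continuous_iff_continuousAt.2 fun t => (hγd t).continuousAt
  have hγ'c : Continuous γ' := e.continuous.comp (by fun_prop)
  set g : ℝ → ℝ := fun t => φ (γ t) with hg
  set g' : ℝ → ℝ := fun t => fderiv ℝ φ (γ t) (γ' t) with hg'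
  have hgd : ∀ t, HasDerivAt g (g' t) t := fun t =>
    ((hφ.differentiable (by simp)) _).hasFDerivAt.comp_hasDerivAt t (hγd t)
  have hg'c : Continuous g' := by
    have := hφ.continuous_fderiv (by simp)
    fun_prop
  -- The angle of the ray on which `φ` vanishes.
  set a := Complex.arg (e.symm θ₀) with ha
  have hga : g a = 0 := by
    have : γ a = r • θ₀ := by
      have h1 : (Real.cos a + Real.sin a * Complex.I : ℂ) = e.symm θ₀ := by
        have := Complex.norm_mul_cos_add_sin_mul_I (e.symm θ₀)
        rw [e.symm.norm_map, hθ₀] at this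
        simpa [ha] using this
      simp only [hγ]
      rw [h1, ← Complex.real_smul, map_smul, e.apply_symm_apply]
    rw [hg]
    simp only [this, h0 r hr0]
  have hpi : -Real.pi ≤ Real.pi := by linarith [Real.pi_pos]
  have hP := integral_sq_le_of_zero (a := -Real.pi) (b := Real.pi) (c := a)
    ⟨(Complex.neg_pi_lt_arg _).le, Complex.arg_le_pi _⟩ hgd hg'c hga
  have hgc' : Continuous g := by fun_prop
  calc _ = ∫⁻ t in Ioo (-Real.pi) Real.pi, ENNReal.ofReal ((r ^ 2)⁻¹ * g t ^ 2) := by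
        refine lintegral_congr fun t => ?_
        change ENNReal.ofReal (φ (γ t) ^ 2 / ‖γ t‖ ^ 2) = _
        rw [hγn, div_eq_inv_mul]
    _ = ENNReal.ofReal ((r ^ 2)⁻¹ * ∫ t in (-Real.pi)..Real.pi, g t ^ 2) := by
        rw [lintegral_Ioo_ofReal hpi (by fun_prop) (fun t _ => by positivity),
          intervalIntegral.integral_const_mul]
    _ ≤ ENNReal.ofReal ((r ^ 2)⁻¹ * ((2 * Real.pi) ^ 2 *
          ∫ t in (-Real.pi)..Real.pi, g' t ^ 2)) := by
        gcongr
        rwa [sub_neg_eq_add, ← two_mul] at hP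
    _ = ENNReal.ofReal ((2 * Real.pi) ^ 2) * ∫⁻ t in Ioo (-Real.pi) Real.pi,
          ENNReal.ofReal ((r ^ 2)⁻¹ * g' t ^ 2) := by
        rw [lintegral_Ioo_ofReal hpi (by fun_prop) (fun t _ => by positivity),
          intervalIntegral.integral_const_mul, ← ENNReal.ofReal_mul (by positivity)]
        congr 1
        ring
    _ ≤ _ := by
        refine mul_le_mul_right (lintegral_mono fun t => ENNReal.ofReal_le_ofReal ?_) _
        have h1 := abs_fderiv_apply_le φ (γ t) (γ' t)
        rw [hγ'n] at h1
        have h2 : g' t ^ 2 ≤ (r * ‖gradient φ (γ t)‖) ^ 2 := by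
          rw [← sq_abs]
          gcongr
        calc (r ^ 2)⁻¹ * g' t ^ 2 ≤ (r ^ 2)⁻¹ * (r * ‖gradient φ (γ t)‖) ^ 2 := by gcongr
          _ = ‖gradient φ (γ t)‖ ^ 2 := by field_simp
          _ ≤ φ (γ t) ^ 2 + ‖gradient φ (γ t)‖ ^ 2 := le_add_of_nonneg_left (sq_nonneg _)

/-- Hardy's inequality on a ball, for functions that vanish on a ray. The ray matters only in
the plane. -/
theorem exists_hardy_ball {n : ℕ} (hn : 2 ≤ n) {ρ : ℝ} (hρ : 0 < ρ) {θ₀ : Rn n}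
    (hθ₀ : ‖θ₀‖ = 1) :
    ∃ C : ℝ, 0 ≤ C ∧ ∀ φ : Rn n → ℝ, ContDiff ℝ ∞ φ → (∀ r : ℝ, 0 < r → φ (r • θ₀) = 0) →
      ∫⁻ x in Metric.ball 0 ρ, ENNReal.ofReal (φ x ^ 2 / ‖x‖ ^ 2)
        ≤ ENNReal.ofReal C *
          ∫⁻ x in Metric.ball 0 ρ, ENNReal.ofReal (φ x ^ 2 + ‖gradient φ x‖ ^ 2) := by
  rcases hn.eq_or_lt with rfl | hn
  · exact ⟨(2 * Real.pi) ^ 2, by positivity, fun φ hφ h0 => hardy_ball_two hφ hθ₀ h0⟩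
  · exact ⟨4 + 2 * n / ρ ^ 2, by positivity, fun φ hφ _ => hardy_ball_of_three_le hn hρ hφ⟩

/-! ### Test functions as elements of Sobolev spaces -/

section Sobolev

variable {n : ℕ} {U V : Set (Rn n)} {ν : Measure (Rn n)} {φ : Rn n → ℝ}

theorem inner_gradient (φ : Rn n → ℝ) (x v : Rn n) : inner ℝ v (gradient φ x) = fderiv ℝ φ x v := by
  rw [real_inner_comm, gradient, InnerProductSpace.toDual_symm_apply]

theorem IsTestFunction.hasCompactSupport_gradient (hφ : IsTestFunction U φ) :
    HasCompactSupport (gradient φ) :=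
  (hφ.2.1.fderiv (𝕜 := ℝ)).comp_left (g := (InnerProductSpace.toDual ℝ (Rn n)).symm) (map_zero _)

theorem IsTestFunction.memLp [IsFiniteMeasureOnCompacts ν] (hφ : IsTestFunction U φ) :
    MemLp φ 2 (ν.restrict V) :=
  (hφ.1.continuous.memLp_of_hasCompactSupport hφ.2.1).restrict V

theorem IsTestFunction.memLp_gradient (hφ : IsTestFunction U φ) :
    MemLp (gradient φ) 2 (volume.restrict V) :=
  ((continuous_gradient hφ.1).memLp_of_hasCompactSupport hφ.hasCompactSupport_gradient).restrict V

theorem isWeakGradient_gradient (hφ : ContDiff ℝ ∞ φ) (V : Set (Rn n)) :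
    IsWeakGradient V φ (gradient φ) := by
  have hgc := continuous_gradient hφ
  refine ⟨hφ.continuous.locallyIntegrable.locallyIntegrableOn V,
    hgc.locallyIntegrable.locallyIntegrableOn V, fun η hη => ?_⟩
  have hηc := continuous_gradient hη.1
  have hηs := hη.hasCompactSupport_gradient
  rw [setIntegral_eq_integral_of_forall_compl_eq_zero fun x hx => by
      rw [hη.gradient_eq_zero hx, smul_zero],
    setIntegral_eq_integral_of_forall_compl_eq_zero fun x hx => by
      rw [hη.apply_eq_zero hx, zero_smul]]
  have i1 : Integrable (fun x => φ x • gradient η x) :=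
    (hφ.continuous.smul hηc).integrable_of_hasCompactSupport hηs.smul_left
  have i2 : Integrable (fun x => η x • gradient φ x) :=
    (hη.1.continuous.smul hgc).integrable_of_hasCompactSupport hη.2.1.smul_right
  have i3 : Integrable (fun x => φ x * η x) :=
    (hφ.continuous.mul hη.1.continuous).integrable_of_hasCompactSupport hη.2.1.mul_left
  refine ext_inner_left ℝ fun v => ?_
  rw [inner_neg_right, ← integral_inner i1, ← integral_inner i2]
  have j1 := i1.const_inner (𝕜 := ℝ) v
  have j2 := i2.const_inner (𝕜 := ℝ) v
  simp only [inner_smul_right, inner_gradient] at j1 j2 ⊢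
  rw [integral_mul_fderiv_eq_neg_fderiv_mul_of_integrable (by simpa only [mul_comm] using j2) j1 i3
    (fun x _ => hφ.differentiable (by simp) x) (fun x _ => hη.1.differentiable (by simp) x)]
  simp only [mul_comm]

theorem exists_sobolev_of_isTestFunction [IsFiniteMeasureOnCompacts ν] (hν : volume ≪ ν)
    (V : Set (Rn n)) (hφ : IsTestFunction U φ) :
    ∃ f : sobolev V ν hν, f.1.fst =ᵐ[ν.restrict V] φ := by
  have h1 : MemLp φ 2 (ν.restrict V) := hφ.memLp
  have h2 : MemLp (gradient φ) 2 (volume.restrict V) := hφ.memLp_gradient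
  exact ⟨⟨WithLp.toLp 2 (h1.toLp φ, h2.toLp _), (isWeakGradient_gradient hφ.1 V).congr
    ((hν.restrict V).ae_eq h1.coeFn_toLp.symm) h2.coeFn_toLp.symm⟩, h1.coeFn_toLp⟩

/-- The distributional gradient of a smooth function is its gradient. -/
theorem IsWeakGradient.ae_eq_gradient (hV : IsOpen V) {u : Rn n → ℝ} {g : Rn n → Rn n}
    (h : IsWeakGradient V u g) (hu : u =ᵐ[volume.restrict V] φ) (hφ : ContDiff ℝ ∞ φ) :
    g =ᵐ[volume.restrict V] gradient φ := by
  have h1 := h.congr hu ae_eq_rfl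
  have h2 := isWeakGradient_gradient hφ V
  have key := hV.ae_eq_zero_of_integral_contDiff_smul_eq_zero (h1.2.1.sub h2.2.1)
    (fun η h3 h4 h5 => by
      have hη : IsTestFunction V η := ⟨h3, h4, h5⟩
      rw [← setIntegral_eq_integral_of_forall_compl_eq_zero (s := V) fun x hx => by
        rw [hη.apply_eq_zero hx, zero_smul]]
      simp only [Pi.sub_apply, smul_sub]
      rw [integral_sub (integrableOn_testFunction_smul h1.2.1 hη)
        (integrableOn_testFunction_smul h2.2.1 hη), sub_eq_zero]
      exact neg_injective ((h1.2.2 η hη).symm.trans (h2.2.2 η hη)))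
  rw [EventuallyEq, ae_restrict_iff' hV.measurableSet]
  filter_upwards [key] with x hx hxV using sub_eq_zero.1 (hx hxV)

theorem ofReal_sq_norm_Lp {E : Type*} [NormedAddCommGroup E] {μ : Measure (Rn n)} (f : Lp E 2 μ)
    {g : Rn n → E} (hfg : f =ᵐ[μ] g) :
    ENNReal.ofReal (‖f‖ ^ 2) = ∫⁻ x, ENNReal.ofReal (‖g x‖ ^ 2) ∂μ := by
  have h := eLpNorm_nnreal_pow_eq_lintegral (f := f) (μ := μ) (p := 2) (by simp)
  rw [ENNReal.ofReal_pow (norm_nonneg _), Lp.norm_def, ENNReal.ofReal_toReal (Lp.eLpNorm_ne_top f)]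
  refine Eq.trans (by simpa using h) (lintegral_congr_ae ?_)
  filter_upwards [hfg] with x hx
  rw [hx, ENNReal.ofReal_pow (norm_nonneg _), ofReal_norm]

/-- The norm of the element of a Sobolev space that is given by a smooth function. -/
theorem ofReal_sq_norm_sobolev (hV : IsOpen V) {hν : volume ≪ ν} (f : sobolev V ν hν)
    (hφ : ContDiff ℝ ∞ φ) (hf : f.1.fst =ᵐ[ν.restrict V] φ) :
    ENNReal.ofReal (‖f‖ ^ 2) = ∫⁻ x in V, ENNReal.ofReal (φ x ^ 2) ∂ν +
      ∫⁻ x in V, ENNReal.ofReal (‖gradient φ x‖ ^ 2) := by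
  have h2 : f.1.snd =ᵐ[volume.restrict V] gradient φ :=
    IsWeakGradient.ae_eq_gradient hV f.2 ((hν.restrict V).ae_eq hf) hφ
  rw [Submodule.coe_norm, WithLp.prod_norm_sq_eq_of_L2,
    ENNReal.ofReal_add (by positivity) (by positivity), ofReal_sq_norm_Lp _ hf,
    ofReal_sq_norm_Lp _ h2]
  simp only [Real.norm_eq_abs, sq_abs]

/-! ### Completeness of the Sobolev spaces -/

/-- On every ball, the Lebesgue measure is bounded by a multiple of `ν`. -/
def LocallyDominatesVolume (ν : Measure (Rn n)) : Prop :=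
  ∀ R : ℝ, ∃ c : ℝ≥0∞, c ≠ ⊤ ∧ volume.restrict (Metric.ball 0 R) ≤ c • ν

theorem locallyDominatesVolume_volume : LocallyDominatesVolume (volume : Measure (Rn n)) :=
  fun _ => ⟨1, by simp, by simpa using Measure.restrict_le_self⟩

theorem restrict_inter_ball_le {R : ℝ} {c : ℝ≥0∞} (hV : MeasurableSet V)
    (h : volume.restrict (Metric.ball 0 R) ≤ c • ν) :
    volume.restrict (V ∩ Metric.ball 0 R) ≤ c • ν.restrict V := by
  rw [← Measure.restrict_restrict hV, ← Measure.restrict_smul]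
  exact Measure.restrict_mono le_rfl h

theorem LocallyDominatesVolume.locallyIntegrableOn {E : Type*} [NormedAddCommGroup E]
    (hν : LocallyDominatesVolume ν) (hV : MeasurableSet V) {u : Rn n → E}
    (hu : MemLp u 2 (ν.restrict V)) : LocallyIntegrableOn u V volume := by
  intro x _
  obtain ⟨c, hc, h⟩ := hν (‖x‖ + 1)
  refine ⟨V ∩ Metric.ball 0 (‖x‖ + 1), inter_mem self_mem_nhdsWithin (mem_nhdsWithin_of_mem_nhds
    (Metric.isOpen_ball.mem_nhds (by simp))), ?_⟩
  have : IsFiniteMeasure (volume.restrict (V ∩ Metric.ball 0 (‖x‖ + 1))) :=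
    ⟨by
      rw [Measure.restrict_apply_univ]
      exact (measure_mono inter_subset_right).trans_lt measure_ball_lt_top⟩
  exact (hu.of_measure_le_smul hc (restrict_inter_ball_le hV h)).integrable (by norm_num)

/-- Integration against a bounded multiplier `B` with bounded support is continuous on
`L²(V, ν)`. -/
theorem LocallyDominatesVolume.continuous_setIntegral {E F : Type*} [NormedAddCommGroup E]
    [NormedSpace ℝ E] [NormedAddCommGroup F] [NormedSpace ℝ F]
    (hν : LocallyDominatesVolume ν) (hac : volume ≪ ν) (hV : MeasurableSet V)
    {B : Rn n → E →L[ℝ] F} {M R : ℝ} (hM : ∀ x, ‖B x‖ ≤ M) (hR : ∀ x ∉ Metric.ball 0 R, B x = 0)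
    (hint : ∀ u : Lp E 2 (ν.restrict V), IntegrableOn (fun x => B x (u x)) V volume) :
    Continuous fun u : Lp E 2 (ν.restrict V) => ∫ x in V, B x (u x) := by
  obtain ⟨c, hc, h⟩ := hν R
  set μ : Measure (Rn n) := volume.restrict (V ∩ Metric.ball 0 R) with hμ
  have hμf : μ univ ≠ ⊤ := by
    rw [hμ, Measure.restrict_apply_univ]
    exact ((measure_mono inter_subset_right).trans_lt measure_ball_lt_top).ne
  set K : ℝ≥0∞ := ENNReal.ofReal M * (c ^ (1 / 2 : ℝ) * μ univ ^ (1 / 2 : ℝ)) with hK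
  have hKt : K ≠ ⊤ := by
    have h1 := ENNReal.rpow_ne_top_of_nonneg (by norm_num : (0 : ℝ) ≤ 1 / 2) hc
    have h2 := ENNReal.rpow_ne_top_of_nonneg (by norm_num : (0 : ℝ) ≤ 1 / 2) hμf
    exact ENNReal.mul_ne_top ENNReal.ofReal_ne_top (ENNReal.mul_ne_top h1 h2)
  refine LipschitzWith.continuous (K := K.toNNReal) fun u v => ?_
  rw [ENNReal.coe_toNNReal hKt, edist_eq_enorm_sub, edist_eq_enorm_sub,
    ← integral_sub (hint u) (hint v)]
  have hle := restrict_inter_ball_le hV h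
  have hsub : (u - v : Lp E 2 (ν.restrict V)) =ᵐ[volume.restrict V] fun x => u x - v x :=
    (hac.restrict V).ae_eq (Lp.coeFn_sub u v)
  calc ‖∫ x in V, (B x (u x) - B x (v x))‖ₑ
      ≤ ∫⁻ x in V, ‖B x (u x) - B x (v x)‖ₑ := enorm_integral_le_lintegral_enorm _
    _ ≤ ∫⁻ x in V, (Metric.ball 0 R).indicator
          (fun x => ENNReal.ofReal M * ‖(u - v : Lp E 2 (ν.restrict V)) x‖ₑ) x := by
        refine lintegral_mono_ae ?_
        filter_upwards [hsub] with x hx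
        by_cases hxR : x ∈ Metric.ball 0 R
        · rw [indicator_of_mem hxR, hx, ← map_sub]
          refine ((B x).le_opENorm _).trans ?_
          gcongr
          rw [← ofReal_norm]
          exact ENNReal.ofReal_le_ofReal (hM x)
        · simp [hR x hxR]
    _ = ENNReal.ofReal M * eLpNorm (u - v : Lp E 2 (ν.restrict V)) 1 μ := by
        rw [lintegral_indicator measurableSet_ball, Measure.restrict_restrict measurableSet_ball,
          inter_comm, lintegral_const_mul' _ _ ENNReal.ofReal_ne_top, eLpNorm_one_eq_lintegral_enorm]
    _ ≤ ENNReal.ofReal M * (c ^ (1 / 2 : ℝ) *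
          eLpNorm (u - v : Lp E 2 (ν.restrict V)) 2 (ν.restrict V) * μ univ ^ (1 / 2 : ℝ)) := by
        gcongr
        have hm : AEStronglyMeasurable (u - v : Lp E 2 (ν.restrict V)) μ :=
          ((Lp.aestronglyMeasurable _).mono_ac (hac.restrict V)).mono_measure
            (Measure.restrict_mono inter_subset_left le_rfl)
        refine (eLpNorm_le_eLpNorm_mul_rpow_measure_univ (q := 2) (by norm_num) hm).trans ?_
        refine mul_le_mul' ?_ (le_of_eq (by norm_num))
        refine (eLpNorm_mono_measure _ hle).trans (le_of_eq ?_)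
        rw [eLpNorm_smul_measure_of_ne_top (by simp), smul_eq_mul]
        norm_num
    _ = K * ‖u - v‖ₑ := by
        rw [Lp.enorm_def, hK]
        ring

/-- Functions in `L²(V, ν) × L²(V)` are locally integrable, so that being a weak gradient amounts to
the identities for all test functions, each of which is a closed condition. -/
theorem LocallyDominatesVolume.isClosed_sobolev (hν : LocallyDominatesVolume ν)
    (hac : volume ≪ ν) (hV : MeasurableSet V) :
    IsClosed (sobolev V ν hac :
      Set (WithLp 2 (Lp ℝ 2 (ν.restrict V) × Lp (Rn n) 2 (volume.restrict V)))) := by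
  have l1 : ∀ u : Lp ℝ 2 (ν.restrict V), LocallyIntegrableOn u V volume := fun u =>
    hν.locallyIntegrableOn hV (Lp.memLp u)
  have l2 : ∀ g : Lp (Rn n) 2 (volume.restrict V), LocallyIntegrableOn g V volume := fun g =>
    locallyDominatesVolume_volume.locallyIntegrableOn hV (Lp.memLp g)
  have e : (sobolev V ν hac :
      Set (WithLp 2 (Lp ℝ 2 (ν.restrict V) × Lp (Rn n) 2 (volume.restrict V)))) =
      ⋂ (φ : Rn n → ℝ) (_ : IsTestFunction V φ),
        {f | ∫ x in V, f.fst x • gradient φ x = -∫ x in V, φ x • f.snd x} := by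
    ext f
    simp only [mem_iInter, mem_ofPred_eq]
    exact ⟨fun h => h.2.2, fun h => ⟨l1 _, l2 _, h⟩⟩
  rw [e]
  refine isClosed_iInter fun φ => isClosed_iInter fun hφ => isClosed_eq ?_ (Continuous.neg ?_)
  · obtain ⟨M, hM⟩ := (hφ.hasCompactSupport_gradient).exists_bound_of_continuous
      (continuous_gradient hφ.1)
    obtain ⟨R, hR⟩ := (hφ.hasCompactSupport_gradient).isCompact.isBounded.subset_ball 0
    have := hν.continuous_setIntegral hac hV (B := fun x =>
        ContinuousLinearMap.toSpanSingleton ℝ (gradient φ x)) (M := M) (R := R)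
      (fun x => by simpa using hM x)
      (fun x hx => by
        rw [image_eq_zero_of_notMem_tsupport fun h => hx (hR h)]
        ext
        simp)
      (fun u => by simpa using integrableOn_smul_gradient (l1 u) hφ)
    simp only [ContinuousLinearMap.toSpanSingleton_apply] at this
    exact this.comp (WithLp.continuous_fst _ _ _)
  · obtain ⟨M, hM⟩ := hφ.2.1.exists_bound_of_continuous hφ.1.continuous
    obtain ⟨R, hR⟩ := hφ.2.1.isCompact.isBounded.subset_ball 0
    have := locallyDominatesVolume_volume.continuous_setIntegral Measure.AbsolutelyContinuous.rfl hV (B := fun x =>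
        φ x • ContinuousLinearMap.id ℝ (Rn n)) (M := M) (R := R)
      (fun x => by
        rw [norm_smul]
        exact (mul_le_of_le_one_right (norm_nonneg _) ContinuousLinearMap.norm_id_le).trans (hM x))
      (fun x hx => by
        rw [image_eq_zero_of_notMem_tsupport fun h => hx (hR h)]
        exact zero_smul ℝ _)
      (fun u => by simpa using integrableOn_testFunction_smul (l2 u) hφ)
    simp only [smul_apply, ContinuousLinearMap.id_apply] at this
    exact this.comp (WithLp.continuous_snd _ _ _)

theorem LocallyDominatesVolume.completeSpace_sobolev (hν : LocallyDominatesVolume ν)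
    (hac : volume ≪ ν) (hV : MeasurableSet V) : CompleteSpace (sobolev V ν hac) :=
  (hν.isClosed_sobolev hac hV).completeSpace_coe

theorem locallyDominatesVolume_weightedVolume : LocallyDominatesVolume (weightedVolume n) := by
  refine fun R => ⟨ENNReal.ofReal ((1 + R) ^ 2), by simp, Measure.le_iff.2 fun s hs => ?_⟩
  rw [Measure.restrict_apply hs, Measure.smul_apply, weightedVolume, withDensity_apply _ hs,
    smul_eq_mul, ← lintegral_const_mul' _ _ ENNReal.ofReal_ne_top, ← setLIntegral_one]
  refine (setLIntegral_mono' (hs.inter measurableSet_ball) fun x hx => ?_).trans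
    (lintegral_mono_set inter_subset_left)
  have hx1 : ‖x‖ < R := by simpa using hx.2
  have := norm_nonneg x
  rw [← ENNReal.ofReal_mul (by positivity), ← ENNReal.ofReal_one, ← div_eq_mul_inv]
  refine ENNReal.ofReal_le_ofReal ((one_le_div (by positivity)).2 ?_)
  gcongr

theorem weightedVolume_le_volume : weightedVolume n ≤ volume := by
  conv_rhs => rw [← withDensity_one (μ := (volume : Measure (Rn n)))]
  refine withDensity_mono (ae_of_all _ fun x => ?_)
  rw [Pi.one_apply, ← ENNReal.ofReal_one]
  refine ENNReal.ofReal_le_ofReal (inv_le_one_of_one_le₀ (one_le_pow₀ ?_))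
  simp

instance : IsFiniteMeasureOnCompacts (weightedVolume n) :=
  ⟨fun _ hK => (weightedVolume_le_volume _).trans_lt hK.measure_lt_top⟩

theorem setLIntegral_weightedVolume (hV : MeasurableSet V) {u : Rn n → ℝ} (hu : Measurable u) :
    ∫⁻ x in V, ENNReal.ofReal (u x ^ 2) ∂weightedVolume n =
      ∫⁻ x in V, ENNReal.ofReal (((1 + ‖x‖) ^ 2)⁻¹ * u x ^ 2) := by
  rw [weightedVolume, setLIntegral_withDensity_eq_setLIntegral_mul _ (by fun_prop) (by fun_prop) hV]
  refine lintegral_congr fun x => ?_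
  rw [Pi.mul_apply, ENNReal.ofReal_mul (by positivity)]

end Sobolev

/-! ### Isomorphisms of closures -/

/-- A continuous linear map that is bounded below on a subspace of a complete space restricts to
an isomorphism between the closures of the subspace and of its image. -/
theorem exists_equiv_topologicalClosure {Z X : Type*} [NormedAddCommGroup Z] [NormedSpace ℝ Z]
    [CompleteSpace Z] [NormedAddCommGroup X] [NormedSpace ℝ X] (L : Z →L[ℝ] X)
    (G : Submodule ℝ Z) {S : Submodule ℝ X} (hS : G.map (L : Z →ₗ[ℝ] X) = S) {C : ℝ}
    (hC : ∀ z ∈ G, ‖z‖ ≤ C * ‖L z‖) :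
    ∃ e : G.topologicalClosure ≃L[ℝ] S.topologicalClosure,
      ∀ z : G.topologicalClosure, (e z : X) = L z := by
  have hmem : ∀ z ∈ G.topologicalClosure, L z ∈ S.topologicalClosure := fun z hz =>
    map_mem_closure L.continuous hz fun y hy => hS ▸ Submodule.mem_map_of_mem hy
  have hbd : ∀ z ∈ G.topologicalClosure, ‖z‖ ≤ C * ‖L z‖ := fun z hz =>
    closure_minimal (s := (G : Set Z)) (t := {z | ‖z‖ ≤ C * ‖L z‖}) hC
      (isClosed_le (by fun_prop) (by fun_prop)) hz
  set f : G.topologicalClosure →ₗ[ℝ] S.topologicalClosure :=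
    (L : Z →ₗ[ℝ] X).restrict hmem with hf
  have hfc : ∀ z, (f z : X) = L z := fun z => rfl
  have hcomp : CompleteSpace G.topologicalClosure :=
    (Submodule.isClosed_topologicalClosure G).completeSpace_coe
  have hanti : AntilipschitzWith C.toNNReal fun z : G.topologicalClosure => L z := by
    refine AddMonoidHomClass.antilipschitz_of_bound (L.comp G.topologicalClosure.subtypeL)
      fun z => ?_
    exact (hbd z z.2).trans
      (mul_le_mul_of_nonneg_right (Real.le_coe_toNNReal C) (norm_nonneg (L z)))
  have hlip : UniformContinuous fun z : G.topologicalClosure => L z :=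
    (L.comp G.topologicalClosure.subtypeL).uniformContinuous
  have hclosed := hanti.isClosed_range hlip
  have hsurj : Function.Surjective f := by
    rintro ⟨x, hx⟩
    have : x ∈ range fun z : G.topologicalClosure => L z := by
      refine closure_minimal ?_ hclosed hx
      rw [← hS]
      rintro _ ⟨z, hz, rfl⟩
      exact ⟨⟨z, G.le_topologicalClosure hz⟩, rfl⟩
    obtain ⟨z, hz⟩ := this
    exact ⟨z, Subtype.ext hz⟩
  have hinj : Function.Injective f := fun z z' h => hanti.injective (congrArg Subtype.val h)
  set e := LinearEquiv.ofBijective f ⟨hinj, hsurj⟩ with he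
  have hec : ∀ z, (e z : X) = L z := hfc
  refine ⟨e.toContinuousLinearEquivOfBounds ‖L‖ C (fun z => L.le_opNorm z) fun x => ?_, hec⟩
  have := hbd _ (e.symm x).2
  rwa [← hec, e.apply_symm_apply] at this

/-- If the components of the elements of a subspace `G` of a product control each other, the closure
of `G` is the graph of an isomorphism between the closures of the projections of `G`. -/
theorem exists_equiv_of_graph {X Y : Type*} [NormedAddCommGroup X] [NormedSpace ℝ X]
    [CompleteSpace X] [NormedAddCommGroup Y] [NormedSpace ℝ Y] [CompleteSpace Y]
    (G : Submodule ℝ (X × Y)) {S : Submodule ℝ X} {S' : Submodule ℝ Y}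
    (hS : ∀ x, x ∈ S ↔ ∃ y, (x, y) ∈ G) (hS' : ∀ y, y ∈ S' ↔ ∃ x, (x, y) ∈ G)
    (h1 : ∃ C : ℝ, ∀ p ∈ G, ‖p.2‖ ≤ C * ‖p.1‖) (h2 : ∃ C : ℝ, ∀ p ∈ G, ‖p.1‖ ≤ C * ‖p.2‖) :
    ∃ T : S.topologicalClosure ≃L[ℝ] S'.topologicalClosure,
      ∀ x : S.topologicalClosure, ((x : X), (T x : Y)) ∈ G.topologicalClosure := by
  obtain ⟨C, hC⟩ := h1
  obtain ⟨C', hC'⟩ := h2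
  have m1 : G.map (ContinuousLinearMap.fst ℝ X Y : X × Y →ₗ[ℝ] X) = S := by
    ext x
    simp [hS]
  have m2 : G.map (ContinuousLinearMap.snd ℝ X Y : X × Y →ₗ[ℝ] Y) = S' := by
    ext x
    simp [hS']
  obtain ⟨e₁, he₁⟩ := exists_equiv_topologicalClosure (ContinuousLinearMap.fst ℝ X Y) G m1
    (C := max 1 C) fun p hp => by
      refine max_le ?_ ((hC p hp).trans ?_)
      · exact le_mul_of_one_le_left (norm_nonneg _) (le_max_left _ _)
      · exact mul_le_mul_of_nonneg_right (le_max_right _ _) (norm_nonneg _)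
  obtain ⟨e₂, he₂⟩ := exists_equiv_topologicalClosure (ContinuousLinearMap.snd ℝ X Y) G m2
    (C := max 1 C') fun p hp => by
      refine max_le ((hC' p hp).trans ?_) ?_
      · exact mul_le_mul_of_nonneg_right (le_max_right _ _) (norm_nonneg _)
      · exact le_mul_of_one_le_left (norm_nonneg _) (le_max_left _ _)
  refine ⟨e₁.symm.trans e₂, fun x => ?_⟩
  obtain ⟨z, rfl⟩ := e₁.surjective x
  rw [ContinuousLinearEquiv.trans_apply, e₁.symm_apply_apply, he₁, he₂]
  exact z.2

/-! ### Energy estimates for the Kelvin transformation in a cone -/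

section Cone

variable {n : ℕ} {ρ : ℝ} {Γ : Set (Rn n)}

/-- The function `0` is admissible in the definition of the capacity of the empty set. -/
theorem sphereCapacity_empty : sphereCapacity (∅ : Set (Metric.sphere (0 : Rn n) 1)) = 0 := by
  refine le_antisymm ?_ bot_le
  refine (iInf_le _ 0).trans ((iInf_le _ contDiff_const).trans ((iInf_le _ (by simp)).trans ?_))
  simp [tangentialGradient, gradient]

/-- A cone that omits a point omits the ray through it. -/
theorem IsOpenCone.smul_notMem (hΓ : IsOpenCone Γ) {θ : Rn n} (hθ : θ ∉ Γ) {r : ℝ} (hr : 0 < r) :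
    r • θ ∉ Γ := fun h => hθ <| by
  simpa [smul_smul, hr.ne'] using hΓ.2 r⁻¹ (by positivity) _ h

/-- The only open cone that contains the origin is the whole space. -/
theorem IsOpenCone.zero_notMem (hΓ : IsOpenCone Γ) {θ : Rn n} (hθ : θ ∉ Γ) : (0 : Rn n) ∉ Γ := by
  intro h0
  have hc : Tendsto (fun r : ℝ => r • θ) (𝓝[>] 0) (𝓝 0) := by
    have : Tendsto (fun r : ℝ => r • θ) (𝓝 0) (𝓝 ((0 : ℝ) • θ)) :=
      (continuous_id.smul continuous_const).tendsto 0
    rw [zero_smul] at this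
    exact this.mono_left nhdsWithin_le_nhds
  obtain ⟨r, hr, hr0⟩ := ((hc.eventually (hΓ.1.mem_nhds h0)).and self_mem_nhdsWithin).exists
  exact hΓ.smul_notMem hθ hr0 hr

/-- The empty set has capacity `0`, so a set of positive capacity has a point. -/
theorem exists_notMem_of_sphereCapacity_pos (hcap : 0 < sphereCapacity (coneSection Γ)ᶜ) :
    ∃ θ : Rn n, ‖θ‖ = 1 ∧ θ ∉ Γ := by
  obtain ⟨θ, hθ⟩ : ((coneSection Γ)ᶜ).Nonempty := by
    rw [nonempty_iff_ne_empty]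
    intro h
    rw [h, sphereCapacity_empty] at hcap
    exact lt_irrefl _ hcap
  exact ⟨θ, by simp, hθ⟩

/-- Hardy's inequality for test functions in a cone. They vanish outside the cone, so the inequality
on the ball applies. -/
theorem exists_hardy_innerCone (hn : 2 ≤ n) (hΓ : IsOpenCone Γ) (hρ : 0 < ρ) {θ₀ : Rn n}
    (hθ₀ : ‖θ₀‖ = 1) (hθΓ : θ₀ ∉ Γ) :
    ∃ C : ℝ, 0 ≤ C ∧ ∀ φ : Rn n → ℝ, IsTestFunction Γ φ →
      ∫⁻ x in innerCone Γ ρ, ENNReal.ofReal (φ x ^ 2 / ‖x‖ ^ 2)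
        ≤ ENNReal.ofReal C *
          ∫⁻ x in innerCone Γ ρ, ENNReal.ofReal (φ x ^ 2 + ‖gradient φ x‖ ^ 2) := by
  obtain ⟨C, hC0, hC⟩ := exists_hardy_ball hn hρ hθ₀
  refine ⟨C, hC0, fun φ hφ => ?_⟩
  have key : ∫⁻ x in innerCone Γ ρ, ENNReal.ofReal (φ x ^ 2 + ‖gradient φ x‖ ^ 2) =
      ∫⁻ x in Metric.ball 0 ρ, ENNReal.ofReal (φ x ^ 2 + ‖gradient φ x‖ ^ 2) := by
    rw [innerCone, ← Measure.restrict_restrict hΓ.1.measurableSet]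
    refine setLIntegral_eq_of_support_subset fun x hx => by_contra fun h => hx ?_
    simp [hφ.apply_eq_zero h, hφ.gradient_eq_zero h]
  rw [key]
  exact (lintegral_mono_set inter_subset_right).trans
    (hC φ hφ.1 fun r hr => hφ.apply_eq_zero (hΓ.smul_notMem hθΓ hr))

/-- The Kelvin transformation is bounded from the inner to the outer energy. The weight
`(1 + |x|)⁻²` at infinity turns into `|y|⁻²` at the vertex, which Hardy's inequality controls. -/
theorem exists_energy_kelvin_outer_le (hn : 2 ≤ n) (hΓ : IsOpenCone Γ) (hρ : 0 < ρ) {θ₀ : Rn n}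
    (hθ₀ : ‖θ₀‖ = 1) (hθΓ : θ₀ ∉ Γ) :
    ∃ C : ℝ, 0 ≤ C ∧ ∀ φ : Rn n → ℝ, IsTestFunction Γ φ →
      ∫⁻ x in outerCone Γ ρ, ENNReal.ofReal (kelvin ρ φ x ^ 2) ∂weightedVolume n +
          ∫⁻ x in outerCone Γ ρ, ENNReal.ofReal (‖gradient (kelvin ρ φ) x‖ ^ 2)
        ≤ ENNReal.ofReal C * ((∫⁻ x in innerCone Γ ρ, ENNReal.ofReal (φ x ^ 2)) +
          ∫⁻ x in innerCone Γ ρ, ENNReal.ofReal (‖gradient φ x‖ ^ 2)) := by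
  have h0 := hΓ.zero_notMem hθΓ
  obtain ⟨C, hC0, hC⟩ := exists_hardy_innerCone hn hΓ hρ hθ₀ hθΓ
  set D : ℝ := 1 + 2 * (n - 2 : ℕ) ^ 2 with hD
  have hD0 : 0 ≤ D := by positivity
  refine ⟨2 + D * C, by positivity, fun φ hφ => ?_⟩
  have hφc := hφ.1.continuous
  have hgc := continuous_gradient hφ.1
  have hVo := (isOpen_outerCone (ρ := ρ) hΓ).measurableSet
  have hVi := (isOpen_innerCone (ρ := ρ) hΓ).measurableSet
  have h0o : (0 : Rn n) ∉ outerCone Γ ρ := fun h => h0 h.1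
  have e1 : ∫⁻ x in outerCone Γ ρ, ENNReal.ofReal (kelvin ρ φ x ^ 2) ∂weightedVolume n ≤
      ∫⁻ x in innerCone Γ ρ, ENNReal.ofReal (φ x ^ 2 / ‖x‖ ^ 2) := by
    rw [setLIntegral_weightedVolume hVo
      (hφ.kelvin hΓ h0 hn hρ).1.continuous.measurable,
      setLIntegral_mul_sq_kelvin hn hρ hVo h0o φ (fun x => ((1 + ‖x‖) ^ 2)⁻¹)
        (fun x => by positivity), image_inversion_outerCone hΓ h0 hρ]
    refine setLIntegral_mono' hVi fun y hy => ENNReal.ofReal_le_ofReal ?_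
    have hy0 : 0 < ‖y‖ := norm_pos_iff.2 (ne_of_mem_of_not_mem hy.1 h0)
    rw [norm_inversion_zero, div_eq_inv_mul (φ y ^ 2)]
    refine mul_le_mul_of_nonneg_right ?_ (sq_nonneg (φ y))
    calc ((1 + ρ ^ 2 / ‖y‖) ^ 2)⁻¹ * (ρ / ‖y‖) ^ 4
        ≤ ((ρ ^ 2 / ‖y‖) ^ 2)⁻¹ * (ρ / ‖y‖) ^ 4 := by
          gcongr
          linarith
      _ = (‖y‖ ^ 2)⁻¹ := by field_simp
  have e2 := setLIntegral_sq_norm_gradient_kelvin_le hn hρ hVo h0o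
    (hφ.1.differentiable (by simp))
  rw [image_inversion_outerCone hΓ h0 hρ] at e2
  have e3 : ∫⁻ x in innerCone Γ ρ, ENNReal.ofReal (φ x ^ 2 + ‖gradient φ x‖ ^ 2) =
      (∫⁻ x in innerCone Γ ρ, ENNReal.ofReal (φ x ^ 2)) +
          ∫⁻ x in innerCone Γ ρ, ENNReal.ofReal (‖gradient φ x‖ ^ 2) := by
    rw [← lintegral_add_left (by fun_prop)]
    exact lintegral_congr fun x => ENNReal.ofReal_add (by positivity) (by positivity)
  rw [← e3]
  calc _ ≤ ∫⁻ x in innerCone Γ ρ, (ENNReal.ofReal (φ x ^ 2 / ‖x‖ ^ 2) +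
          ENNReal.ofReal (2 * ‖gradient φ x‖ ^ 2 + 2 * (n - 2 : ℕ) ^ 2 *
            (φ x ^ 2 / ‖x‖ ^ 2))) := by
        rw [lintegral_add_left (by fun_prop)]
        exact add_le_add e1 e2
    _ ≤ ∫⁻ x in innerCone Γ ρ, (ENNReal.ofReal 2 * ENNReal.ofReal (φ x ^ 2 + ‖gradient φ x‖ ^ 2) +
          ENNReal.ofReal D * ENNReal.ofReal (φ x ^ 2 / ‖x‖ ^ 2)) := by
        refine lintegral_mono fun x => ?_
        rw [← ENNReal.ofReal_add (by positivity) (by positivity),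
          ← ENNReal.ofReal_mul (by positivity), ← ENNReal.ofReal_mul hD0,
          ← ENNReal.ofReal_add (by positivity) (by positivity)]
        refine ENNReal.ofReal_le_ofReal ?_
        rw [hD]
        nlinarith [sq_nonneg (φ x)]
    _ = ENNReal.ofReal 2 *
            (∫⁻ x in innerCone Γ ρ, ENNReal.ofReal (φ x ^ 2 + ‖gradient φ x‖ ^ 2)) +
          ENNReal.ofReal D * ∫⁻ x in innerCone Γ ρ, ENNReal.ofReal (φ x ^ 2 / ‖x‖ ^ 2) := by
        rw [lintegral_add_left (by fun_prop), lintegral_const_mul' _ _ ENNReal.ofReal_ne_top,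
          lintegral_const_mul' _ _ ENNReal.ofReal_ne_top]
    _ ≤ _ := by
        rw [ENNReal.ofReal_add zero_le_two (mul_nonneg hD0 hC0), ENNReal.ofReal_mul hD0, add_mul,
          mul_assoc]
        gcongr
        exact hC φ hφ

/-- The Kelvin transformation is bounded from the outer to the inner energy. No Hardy inequality is
needed: outside the ball of radius `ρ`, the weights `|x|⁻²` and `(1 + |x|)⁻²` are comparable. -/
theorem exists_energy_kelvin_inner_le (hn : 2 ≤ n) (hΓ : IsOpenCone Γ) (h0 : (0 : Rn n) ∉ Γ)
    (hρ : 0 < ρ) :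
    ∃ C : ℝ, 0 ≤ C ∧ ∀ φ : Rn n → ℝ, IsTestFunction Γ φ →
      (∫⁻ x in innerCone Γ ρ, ENNReal.ofReal (kelvin ρ φ x ^ 2)) +
          ∫⁻ x in innerCone Γ ρ, ENNReal.ofReal (‖gradient (kelvin ρ φ) x‖ ^ 2)
        ≤ ENNReal.ofReal C * (∫⁻ x in outerCone Γ ρ, ENNReal.ofReal (φ x ^ 2) ∂weightedVolume n +
          ∫⁻ x in outerCone Γ ρ, ENNReal.ofReal (‖gradient φ x‖ ^ 2)) := by
  set D : ℝ := (1 + ρ) ^ 2 with hD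
  set k : ℝ := 2 * (n - 2 : ℕ) ^ 2 with hk
  have hk0 : 0 ≤ k := by positivity
  refine ⟨2 + (D + k * (D / ρ ^ 2)), by positivity, fun φ hφ => ?_⟩
  have hφc := hφ.1.continuous
  have hgc := continuous_gradient hφ.1
  have hVo := (isOpen_outerCone (ρ := ρ) hΓ).measurableSet
  have hVi := (isOpen_innerCone (ρ := ρ) hΓ).measurableSet
  have h0i : (0 : Rn n) ∉ innerCone Γ ρ := fun h => h0 h.1
  have e1 := setLIntegral_mul_sq_kelvin hn hρ hVi h0i φ (fun _ => 1) (fun _ => zero_le_one)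
  have e2 := setLIntegral_sq_norm_gradient_kelvin_le hn hρ hVi h0i
    (hφ.1.differentiable (by simp))
  rw [image_inversion_innerCone hΓ h0 hρ] at e1 e2
  simp only [one_mul] at e1
  rw [e1, setLIntegral_weightedVolume hVo hφc.measurable]
  calc _ ≤ ∫⁻ x in outerCone Γ ρ, (ENNReal.ofReal ((ρ / ‖x‖) ^ 4 * φ x ^ 2) +
          ENNReal.ofReal (2 * ‖gradient φ x‖ ^ 2 + k * (φ x ^ 2 / ‖x‖ ^ 2))) := by
        rw [lintegral_add_left (by fun_prop)]
        gcongr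
    _ ≤ ∫⁻ x in outerCone Γ ρ, ENNReal.ofReal (2 + (D + k * (D / ρ ^ 2))) *
          (ENNReal.ofReal (((1 + ‖x‖) ^ 2)⁻¹ * φ x ^ 2) +
            ENNReal.ofReal (‖gradient φ x‖ ^ 2)) := by
        refine setLIntegral_mono' hVo fun x hx => ?_
        rw [← ENNReal.ofReal_add (by positivity) (by positivity),
          ← ENNReal.ofReal_add (by positivity) (by positivity),
          ← ENNReal.ofReal_mul (by positivity)]
        refine ENNReal.ofReal_le_ofReal ?_
        have hx1 : ρ < ‖x‖ := by simpa using hx.2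
        have hx0 : 0 < ‖x‖ := hρ.trans hx1
        set w := ((1 + ‖x‖) ^ 2)⁻¹ * φ x ^ 2 with hw
        have hw0 : 0 ≤ w := by positivity
        have hr : ρ / ‖x‖ ≤ (1 + ρ) / (1 + ‖x‖) := by
          rw [div_le_div_iff₀ hx0 (by positivity)]
          nlinarith
        have hr2 : (ρ / ‖x‖) ^ 2 ≤ D * ((1 + ‖x‖) ^ 2)⁻¹ := by
          rw [hD, ← div_eq_mul_inv, ← div_pow]
          gcongr
        have hr1 : ρ / ‖x‖ ≤ 1 := (div_le_one hx0).2 hx1.le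
        have a1 : (ρ / ‖x‖) ^ 4 * φ x ^ 2 ≤ D * w := by
          rw [hw, ← mul_assoc]
          gcongr
          exact (pow_le_pow_of_le_one (by positivity) hr1 (by norm_num)).trans hr2
        have a2 : φ x ^ 2 / ‖x‖ ^ 2 ≤ D / ρ ^ 2 * w := by
          calc φ x ^ 2 / ‖x‖ ^ 2 = (ρ / ‖x‖) ^ 2 * φ x ^ 2 / ρ ^ 2 := by field_simp
            _ ≤ D * ((1 + ‖x‖) ^ 2)⁻¹ * φ x ^ 2 / ρ ^ 2 := by gcongr
            _ = _ := by rw [hw]; ring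
        have a3 : k * (φ x ^ 2 / ‖x‖ ^ 2) ≤ k * (D / ρ ^ 2 * w) := by gcongr
        have a4 : 0 ≤ (D + k * (D / ρ ^ 2)) * ‖gradient φ x‖ ^ 2 := by positivity
        linarith
    _ = _ := by
        rw [lintegral_const_mul' _ _ ENNReal.ofReal_ne_top, lintegral_add_left (by fun_prop)]

end Cone

/-! ### The graph of the Kelvin transformation -/

section Graph

variable {n : ℕ} {ρ : ℝ} {Γ : Set (Rn n)}

theorem sobolev_coeFn_fst_add {V : Set (Rn n)} {ν : Measure (Rn n)} {hν : volume ≪ ν}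
    (f g : sobolev V ν hν) :
    ((f + g).1.fst : Rn n → ℝ) =ᵐ[ν.restrict V] (f.1.fst : Rn n → ℝ) + (g.1.fst : Rn n → ℝ) :=
  Lp.coeFn_add f.1.fst g.1.fst

theorem sobolev_coeFn_fst_smul {V : Set (Rn n)} {ν : Measure (Rn n)} {hν : volume ≪ ν}
    (c : ℝ) (f : sobolev V ν hν) :
    ((c • f).1.fst : Rn n → ℝ) =ᵐ[ν.restrict V] c • (f.1.fst : Rn n → ℝ) :=
  Lp.coeFn_smul c f.1.fst

/-- `f` and `h` are the restrictions of a test function in `Γ` and of its Kelvin transform. -/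
def IsKelvinPair (Γ : Set (Rn n)) (ρ : ℝ) (f : H1 (innerCone Γ ρ)) (h : H1w (outerCone Γ ρ)) :
    Prop :=
  ∃ φ : Rn n → ℝ, IsTestFunction Γ φ ∧
    (f.1.fst : Rn n → ℝ) =ᵐ[volume.restrict (innerCone Γ ρ)] φ ∧
    (h.1.fst : Rn n → ℝ) =ᵐ[(weightedVolume n).restrict (outerCone Γ ρ)] kelvin ρ φ

theorem isKelvinPair_zero (hρ : 0 < ρ) : IsKelvinPair Γ ρ 0 0 :=
  ⟨0, isTestFunction_zero, Lp.coeFn_zero _ _ _, by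
    rw [kelvin_zero hρ]
    exact Lp.coeFn_zero _ _ _⟩

theorem IsKelvinPair.add (hρ : 0 < ρ) {f f' : H1 (innerCone Γ ρ)} {h h' : H1w (outerCone Γ ρ)}
    (hp : IsKelvinPair Γ ρ f h) (hq : IsKelvinPair Γ ρ f' h') :
    IsKelvinPair Γ ρ (f + f') (h + h') := by
  obtain ⟨φ, hφ, h1, h2⟩ := hp
  obtain ⟨ψ, hψ, h3, h4⟩ := hq
  refine ⟨φ + ψ, hφ.add hψ, (sobolev_coeFn_fst_add f f').trans (h1.add h3), ?_⟩
  rw [kelvin_add hρ]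
  exact (sobolev_coeFn_fst_add h h').trans (h2.add h4)

theorem IsKelvinPair.smul (hρ : 0 < ρ) (c : ℝ) {f : H1 (innerCone Γ ρ)}
    {h : H1w (outerCone Γ ρ)} (hp : IsKelvinPair Γ ρ f h) : IsKelvinPair Γ ρ (c • f) (c • h) := by
  obtain ⟨φ, hφ, h1, h2⟩ := hp
  refine ⟨c • φ, hφ.smul c, (sobolev_coeFn_fst_smul c f).trans (h1.const_smul c), ?_⟩
  rw [kelvin_smul hρ]
  exact (sobolev_coeFn_fst_smul c h).trans (h2.const_smul c)

/-- The graph of the Kelvin transformation on the restrictions of test functions in `Γ`. -/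
def kelvinGraph (Γ : Set (Rn n)) (hρ : 0 < ρ) :
    Submodule ℝ (H1 (innerCone Γ ρ) × H1w (outerCone Γ ρ)) where
  carrier := {p | IsKelvinPair Γ ρ p.1 p.2}
  zero_mem' := isKelvinPair_zero hρ
  add_mem' := fun hp hq => hp.add hρ hq
  smul_mem' := fun c _ hp => hp.smul hρ c

theorem mem_smoothPart_iff_exists_kelvinPair (hn : 2 ≤ n) (hΓ : IsOpenCone Γ)
    (h0 : (0 : Rn n) ∉ Γ) (hρ : 0 < ρ) (f : H1 (innerCone Γ ρ)) :
    f ∈ smoothPart Γ (innerCone Γ ρ) volume Measure.AbsolutelyContinuous.rfl ↔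
      ∃ h, IsKelvinPair Γ ρ f h := by
  constructor
  · rintro ⟨φ, hφ, h1⟩
    obtain ⟨h, hh⟩ := exists_sobolev_of_isTestFunction (volume_ac_weightedVolume n)
      (outerCone Γ ρ) (hφ.kelvin hΓ h0 hn hρ)
    exact ⟨h, φ, hφ, h1, hh⟩
  · rintro ⟨h, φ, hφ, h1, -⟩
    exact ⟨φ, hφ, h1⟩

/-- The counterpart of `mem_smoothPart_iff_exists_kelvinPair` for the second component. It rests on
the Kelvin transformation being an involution. -/
theorem mem_smoothPart_weighted_iff_exists_kelvinPair (hn : 2 ≤ n) (hΓ : IsOpenCone Γ)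
    (h0 : (0 : Rn n) ∉ Γ) (hρ : 0 < ρ) (h : H1w (outerCone Γ ρ)) :
    h ∈ smoothPart Γ (outerCone Γ ρ) (weightedVolume n) (volume_ac_weightedVolume n) ↔
      ∃ f, IsKelvinPair Γ ρ f h := by
  constructor
  · rintro ⟨ψ, hψ, hh⟩
    have hK := hψ.kelvin hΓ h0 hn hρ
    obtain ⟨f, hf⟩ := exists_sobolev_of_isTestFunction Measure.AbsolutelyContinuous.rfl
      (innerCone Γ ρ) hK
    refine ⟨f, _, hK, hf, ?_⟩
    rwa [kelvin_kelvin hn hρ (hψ.apply_eq_zero h0)]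
  · rintro ⟨f, φ, hφ, -, h2⟩
    exact ⟨_, hφ.kelvin hΓ h0 hn hρ, h2⟩

theorem norm_le_sqrt_mul_norm {X Y : Type*} [NormedAddCommGroup X] [NormedAddCommGroup Y] {x : X}
    {y : Y} {C : ℝ} (hC : 0 ≤ C)
    (h : ENNReal.ofReal (‖x‖ ^ 2) ≤ ENNReal.ofReal C * ENNReal.ofReal (‖y‖ ^ 2)) :
    ‖x‖ ≤ √C * ‖y‖ := by
  rw [← ENNReal.ofReal_mul hC, ENNReal.ofReal_le_ofReal_iff (by positivity)] at h
  refine le_of_sq_le_sq ?_ (by positivity)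
  rwa [mul_pow, Real.sq_sqrt hC]

theorem exists_norm_snd_kelvinGraph_le (hn : 2 ≤ n) (hΓ : IsOpenCone Γ) (hρ : 0 < ρ) {θ₀ : Rn n}
    (hθ₀ : ‖θ₀‖ = 1) (hθΓ : θ₀ ∉ Γ) :
    ∃ C : ℝ, ∀ p ∈ kelvinGraph Γ hρ, ‖p.2‖ ≤ C * ‖p.1‖ := by
  obtain ⟨C, hC0, hC⟩ := exists_energy_kelvin_outer_le hn hΓ hρ hθ₀ hθΓ
  refine ⟨√C, ?_⟩
  rintro p ⟨φ, hφ, h1, h2⟩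
  refine norm_le_sqrt_mul_norm hC0 ?_
  rw [ofReal_sq_norm_sobolev (isOpen_innerCone hΓ) _ hφ.1 h1,
    ofReal_sq_norm_sobolev (isOpen_outerCone hΓ) _
      (hφ.kelvin hΓ (hΓ.zero_notMem hθΓ) hn hρ).1 h2]
  exact hC φ hφ

theorem exists_norm_fst_kelvinGraph_le (hn : 2 ≤ n) (hΓ : IsOpenCone Γ) (h0 : (0 : Rn n) ∉ Γ)
    (hρ : 0 < ρ) :
    ∃ C : ℝ, ∀ p ∈ kelvinGraph Γ hρ, ‖p.1‖ ≤ C * ‖p.2‖ := by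
  obtain ⟨C, hC0, hC⟩ := exists_energy_kelvin_inner_le hn hΓ h0 hρ
  refine ⟨√C, ?_⟩
  rintro p ⟨φ, hφ, h1, h2⟩
  have hK := hφ.kelvin hΓ h0 hn hρ
  refine norm_le_sqrt_mul_norm hC0 ?_
  rw [ofReal_sq_norm_sobolev (isOpen_innerCone hΓ) _ hφ.1 h1,
    ofReal_sq_norm_sobolev (isOpen_outerCone hΓ) _ hK.1 h2]
  have := hC _ hK
  rwa [kelvin_kelvin hn hρ (hφ.apply_eq_zero h0)] at this

theorem exists_subseq_ae_tendsto {μ : Measure (Rn n)} {u : ℕ → Lp ℝ 2 μ} {v : Lp ℝ 2 μ}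
    (h : Tendsto u atTop (𝓝 v)) :
    ∃ ns : ℕ → ℕ, StrictMono ns ∧
      ∀ᵐ x ∂μ, Tendsto (fun i => (u (ns i) : Rn n → ℝ) x) atTop (𝓝 ((v : Rn n → ℝ) x)) :=
  (tendstoInMeasure_of_tendsto_Lp h).exists_seq_tendsto_ae

/-- On the closure of the graph, the second component still is the Kelvin transform of the first:
convergence in `L²` gives convergence almost everywhere along a subsequence, and the inversion
preserves null sets. -/
theorem ae_eq_kelvin_of_mem_closure (hΓ : IsOpenCone Γ) (h0 : (0 : Rn n) ∉ Γ)
    (hρ : 0 < ρ) {p : H1 (innerCone Γ ρ) × H1w (outerCone Γ ρ)}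
    (hp : p ∈ (kelvinGraph Γ hρ).topologicalClosure) :
    (p.2.1.fst : Rn n → ℝ) =ᵐ[volume.restrict (outerCone Γ ρ)]
      kelvin ρ (p.1.1.fst : Rn n → ℝ) := by
  obtain ⟨q, hq, hqp⟩ := mem_closure_iff_seq_limit.1 hp
  choose φ hφ hφ1 hφ2 using hq
  have t1 : Tendsto (fun k => (q k).1.1.fst) atTop (𝓝 p.1.1.fst) :=
    (((WithLp.continuous_fst _ _ _).comp (continuous_subtype_val.comp
      continuous_fst)).tendsto p).comp hqp
  have t2 : Tendsto (fun k => (q k).2.1.fst) atTop (𝓝 p.2.1.fst) :=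
    (((WithLp.continuous_fst _ _ _).comp (continuous_subtype_val.comp
      continuous_snd)).tendsto p).comp hqp
  obtain ⟨a, ha, ha'⟩ := exists_subseq_ae_tendsto t1
  obtain ⟨b, hb, hb'⟩ := exists_subseq_ae_tendsto (t2.comp ha.tendsto_atTop)
  have hac := (volume_ac_weightedVolume n).restrict (outerCone Γ ρ)
  have hV := (isOpen_outerCone (ρ := ρ) hΓ).measurableSet
  have h0o : (0 : Rn n) ∉ outerCone Γ ρ := fun h => h0 h.1
  have hI := ae_comp_inversion hρ hV h0o (p := fun y =>
    (∀ k, ((q k).1.1.fst : Rn n → ℝ) y = φ k y) ∧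
      Tendsto (fun i => ((q (a i)).1.1.fst : Rn n → ℝ) y) atTop
        (𝓝 ((p.1.1.fst : Rn n → ℝ) y))) (by
    rw [image_inversion_outerCone hΓ h0 hρ]
    exact (ae_all_iff.2 hφ1).and ha')
  filter_upwards [hI, hac.ae_le hb', hac.ae_le (ae_all_iff.2 hφ2)] with x hx hx2 hx3
  refine tendsto_nhds_unique hx2 ?_
  have hs := (hx.2.comp hb.tendsto_atTop).const_mul ((‖x‖ / ρ) ^ ((2 : ℤ) - n))
  rw [kelvin_eq_zpow hρ]
  refine hs.congr fun i => ?_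
  simp only [Function.comp_apply]
  rw [hx3, kelvin_eq_zpow hρ, hx.1]

theorem completeSpace_H1_innerCone (hΓ : IsOpenCone Γ) : CompleteSpace (H1 (innerCone Γ ρ)) :=
  locallyDominatesVolume_volume.completeSpace_sobolev _ (isOpen_innerCone hΓ).measurableSet

theorem completeSpace_H1w_outerCone (hΓ : IsOpenCone Γ) : CompleteSpace (H1w (outerCone Γ ρ)) :=
  locallyDominatesVolume_weightedVolume.completeSpace_sobolev _ (isOpen_outerCone hΓ).measurableSet

/-- The closure of the graph of the Kelvin transformation on test functions is the graph of an
isomorphism. -/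
theorem exists_equiv_kelvinGraph (hn : 2 ≤ n) (hΓ : IsOpenCone Γ) (hρ : 0 < ρ)
    {θ₀ : Rn n} (hθ₀ : ‖θ₀‖ = 1) (hθΓ : θ₀ ∉ Γ) :
    ∃ T : H10Inner Γ ρ ≃L[ℝ] H1w0Outer Γ ρ,
      ∀ u : H10Inner Γ ρ, (u.1, (T u).1) ∈ (kelvinGraph Γ hρ).topologicalClosure := by
  have h0 := hΓ.zero_notMem hθΓ
  have := completeSpace_H1_innerCone (ρ := ρ) hΓ
  have := completeSpace_H1w_outerCone (ρ := ρ) hΓ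
  exact exists_equiv_of_graph (kelvinGraph Γ hρ)
    (mem_smoothPart_iff_exists_kelvinPair hn hΓ h0 hρ)
    (mem_smoothPart_weighted_iff_exists_kelvinPair hn hΓ h0 hρ)
    (exists_norm_snd_kelvinGraph_le hn hΓ hρ hθ₀ hθΓ) (exists_norm_fst_kelvinGraph_le hn hΓ h0 hρ)

end Graph

end KelvinCone

theorem lemmaA1 (n : ℕ) (hn : 2 ≤ n) (Γ : Set (KelvinCone.Rn n)) (hΓ : KelvinCone.IsOpenCone Γ)
    (hcap : 0 < KelvinCone.sphereCapacity (KelvinCone.coneSection Γ)ᶜ) (ρ : ℝ) (hρ : 0 < ρ) :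
    ∃ T : KelvinCone.H10Inner Γ ρ ≃L[ℝ] KelvinCone.H1w0Outer Γ ρ,
      ∀ u : KelvinCone.H10Inner Γ ρ,
        ((T u).1.1.fst : KelvinCone.Rn n → ℝ)
          =ᵐ[volume.restrict (KelvinCone.outerCone Γ ρ)]
            KelvinCone.kelvin ρ (u.1.1.fst : KelvinCone.Rn n → ℝ) := by
  exact (KelvinCone.exists_notMem_of_sphereCapacity_pos hcap).elim fun θ hθ =>
    (KelvinCone.exists_equiv_kelvinGraph hn hΓ hρ hθ.1 hθ.2).imp fun T hT u =>
      KelvinCone.ae_eq_kelvin_of_mem_closure hΓ (hΓ.zero_notMem hθ.2) hρ (hT u)
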